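/- Let $m\ge 0$, $K_1,\dots,K_m\ge 0$ be integers and $K=K_1+\dots+K_m$; split $\{1,\dots,K\}$ into consecutive blocks $B_1,\dots,B_m$ of sizes $K_1,\dots,K_m$. Let $\alpha_2\in i\mathbb R\setminus\{0\}$, $c_1\in\mathbb R$, $\mu_s\in\{1,-1\}$ $(1\le s\le m)$ and $\lambda_j,\nu_j\in\mathbb C$ $(1\le j\le K)$, with $\lambda_j+\bar\lambda_i\neq0$ whenever $i,j$ lie in the same block and $\nu_j+\bar\nu_i\ne0$ for all $i,j$. For $(x,y,t_2)\in\mathbb R^3$ let $\varphi=(\varphi_1,\dots,\varphi_K)$ be the row vector $$\varphi_j=\exp\Big\{\tfrac{\nu_j^2+c_1\lambda_j^2}{\alpha_2}t_2+\nu_jx+\lambda_jy\Big\},$$ let $C=\mathrm{diag}(C_{K_1},\dots,C_{K_m})$ be block diagonal with $C_{K_s}=\big(\mu_s/(\lambda_j+\bar\lambda_i)\big)_{i,j\in B_s}$, let $D^{-1}\{\varphi^*\varphi\}=\big(\bar\varphi_i\varphi_j/(\nu_j+\bar\nu_i)\big)_{i,j=1}^K$, $\Delta=C+D^{-1}\{\varphi^*\varphi\}$,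 $\Phi=\varphi\Delta^{-1}$, and let $P$ be the $K\times m$ matrix whose $s$-th column $P_{\cdot s}$ is $1$ on $B_s$ and $0$ elsewhere. Put $$\mathbf q=(q_1,\dots,q_m)=\varphi\Delta^{-1}P,\qquad v_0=2(\varphi\Delta^{-1}\varphi^*)_x,\qquad S=2P^*(\Delta^{-1})_yP,$$ and $U=\{(x,y,t_2)\in\mathbb R^3:\det\Delta\neq0\}$. (1) $U$ is open, $q_i,v_0,S_{ji}$ are $C^\infty$ on $U$, and on $U$ they satisfy the $m$-component Davey–Stewartson system $$\alpha_2q_{i,t_2}=q_{i,xx}+c_1q_{i,yy}+v_0q_i-c_1\sum_{j=1}^m\mu_jq_jS_{ji},\qquad v_{0,y}=2\Big(\sum_{j=1}^m\mu_j|q_j|^2\Big)_x,\qquad S_{ji,x}=-2(\bar q_jq_i)_y\qquad(1\le i,j\le m).$$ Moreover on $U$ $$q_j=\sum_{i\in B_j}\Phi_i=-\frac{\det\begin{pmatrix}\Delta&P_{\cdot j}\\ \varphi&0\end{pmatrix}}{\det\Delta},\qquad v_0=-2\left(\frac{\det\begin{pmatrix}\Delta&\varphi^*\\ \varphi&0\end{pmatrix}}{\det\Delta}\right)_x,\qquad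 S_{ij}=-2\left(\frac{\det\begin{pmatrix}\Delta&P_{\cdot j}\\ (P_{\cdot i})^*&0\end{pmatrix}}{\det\Delta}\right)_y .$$ (2) Let $m=1$ and $\mu_1=1$, suppose that $\mathrm{Re}\,\lambda_j\,\mathrm{Re}\,\nu_j>0$ for every $j$, and that the $\lambda_j$ are pairwise distinct, or the $\nu_j$ are pairwise distinct, or, more generally, that $\det\Delta$ is not identically zero. Then the solution is regular: $\det\Delta\ne0$ on all of $\mathbb R^3$, so that $q,v_0,S$ are $C^\infty$ and solve the system on $\mathbb R^3$. (3) Let $m=1$, $K=1$, with $\mathrm{Re}\,\lambda_1\neq0\neq\mathrm{Re}\,\nu_1$, and let $\theta=\frac{\nu_1^2+c_1\lambda_1^2}{\alpha_2}t_2+\nu_1x+\lambda_1y$. Then $\Delta=\frac{\mu_1}{2\mathrm{Re}\lambda_1}+\frac1{2\mathrm{Re}\nu_1}e^{2\mathrm{Re}\theta}$, and where $\Delta\ne0$ $$q=\frac{e^\theta}{\Delta},\qquad S=-2\frac{\mathrm{Re}(\lambda_1)e^{2\mathrm{Re}\theta}}{\mathrm{Re}(\nu_1)\Delta^2},\qquad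 v_0=2\mu_1\frac{\mathrm{Re}(\nu_1)e^{2\mathrm{Re}\theta}}{\mathrm{Re}(\lambda_1)\Delta^2};$$ these explicit functions are $C^\infty$ and solve the system on the open set $\{\Delta\neq0\}$. Suppose $\mathrm{Re}\,\lambda_1\,\mathrm{Re}\,\nu_1>0$. If $\mu_1=1$, this one-soliton is regular: $\Delta$ vanishes nowhere, and the functions are $C^\infty$ and solve the system on $\mathbb R^3$. If $\mu_1=-1$, it is singular: $\Delta$ vanishes at some point of $\mathbb R^3$, and $|q|\to\infty$ there as that point is approached within $\{\Delta\ne0\}$. -/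

import Mathlib

open scoped ContDiff Matrix

noncomputable section

namespace VectorDS

/-- Points `(x, y, t)` of space-time, where `t` stands for `t_2`. -/
abbrev Pt : Type := ℝ × ℝ × ℝ

/-- Partial derivative in `x`. -/
def dX (f : Pt → ℂ) (p : Pt) : ℂ := deriv (fun s : ℝ => f (s, p.2.1, p.2.2)) p.1

/-- Partial derivative in `y`. -/
def dY (f : Pt → ℂ) (p : Pt) : ℂ := deriv (fun s : ℝ => f (p.1, s, p.2.2)) p.2.1

/-- Partial derivative in `t`. -/
def dT (f : Pt → ℂ) (p : Pt) : ℂ := deriv (fun s : ℝ => f (p.1, p.2.1, s)) p.2.2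

/-- Smooth solutions `(q, v, S)`, on an open set `U`, of the `m`-component Davey-Stewartson system
with coefficients `α`, `c` and `μ_1, …, μ_m`. -/
structure IsDSSolutionOn {m : ℕ} (α : ℂ) (c : ℝ) (μ : Fin m → ℝ) (U : Set Pt)
    (q : Fin m → Pt → ℂ) (v : Pt → ℂ) (S : Fin m → Fin m → Pt → ℂ) : Prop where
  isOpen : IsOpen U
  smooth_q : ∀ i, ContDiffOn ℝ ∞ (q i) U
  smooth_v : ContDiffOn ℝ ∞ v U
  smooth_S : ∀ j i, ContDiffOn ℝ ∞ (S j i) U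
  eq_q : ∀ i, ∀ p ∈ U, α * dT (q i) p =
    dX (dX (q i)) p + (c : ℂ) * dY (dY (q i)) p + v p * q i p
      - (c : ℂ) * ∑ j, (μ j : ℂ) * q j p * S j i p
  eq_v : ∀ p ∈ U, dY v p = 2 * dX (fun r => ∑ j, (μ j : ℂ) * ((‖q j r‖ ^ 2 : ℝ) : ℂ)) p
  eq_S : ∀ j i, ∀ p ∈ U, dX (S j i) p = -2 * dY (fun r => star (q j r) * q i r) p

/-- The parameters of the construction: block sizes `K_s`, coefficients `α = α_2`, `c = c_1`,
signs `μ_s`, and the spectral parameters `λ`, `ν`. The index `⟨s, i⟩` is the `i`-th index of the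
`s`-th block, so that `λ ⟨s, ·⟩` are the `λ`'s belonging to block `s`. -/
structure Params (m : ℕ) where
  K : Fin m → ℕ
  α : ℂ
  c : ℝ
  μ : Fin m → ℝ
  lam : (Σ s : Fin m, Fin (K s)) → ℂ
  nu : (Σ s : Fin m, Fin (K s)) → ℂ

namespace Params

variable {m : ℕ} (d : Params m)

/-- The index set of cardinality `K_1 + ⋯ + K_m`. -/
abbrev Idx : Type := Σ s : Fin m, Fin (d.K s)

/-- `α ∈ iℝ \ {0}`, `μ_s = ±1`, and no denominator in the construction vanishes. -/
structure Admissible : Prop where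
  α_re : d.α.re = 0
  α_ne : d.α ≠ 0
  μ_sign : ∀ s, d.μ s = 1 ∨ d.μ s = -1
  lam_ne : ∀ (s : Fin m) (i j : Fin (d.K s)), d.lam ⟨s, j⟩ + star (d.lam ⟨s, i⟩) ≠ 0
  nu_ne : ∀ a b : d.Idx, d.nu b + star (d.nu a) ≠ 0

/-- The row vector `φ = (φ_1, …, φ_K)`. -/
def phi (p : Pt) (a : d.Idx) : ℂ :=
  Complex.exp ((d.nu a ^ 2 + (d.c : ℂ) * d.lam a ^ 2) / d.α * (p.2.2 : ℂ)
    + d.nu a * (p.1 : ℂ) + d.lam a * (p.2.1 : ℂ))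

/-- The block diagonal matrix `C` with blocks `C_{K_s} = (μ_s / (λ_j + conj λ_i))`. -/
def C : Matrix d.Idx d.Idx ℂ :=
  Matrix.blockDiagonal' fun s => Matrix.of fun i j : Fin (d.K s) =>
    (d.μ s : ℂ) * (1 / (d.lam ⟨s, j⟩ + star (d.lam ⟨s, i⟩)))

/-- The `x`-antiderivative `D⁻¹{φ^* φ}`, in its exponential normalization. -/
def gram (p : Pt) : Matrix d.Idx d.Idx ℂ :=
  Matrix.of fun i j => star (d.phi p i) * d.phi p j / (d.nu j + star (d.nu i))

/-- `Δ = C + D⁻¹{φ^* φ}`. -/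
def Delta (p : Pt) : Matrix d.Idx d.Idx ℂ := d.C + d.gram p

/-- `P = (e_{K_1}, …, e_{K_m})`; its `s`-th column is `1` on the `s`-th block and `0` elsewhere. -/
def P : Matrix d.Idx (Fin m) ℂ := Matrix.of fun a s => if a.1 = s then 1 else 0

/-- `Φ = φ Δ⁻¹`. -/
def Phi (p : Pt) : d.Idx → ℂ := d.phi p ᵥ* (d.Delta p)⁻¹

/-- `q = φ Δ⁻¹ P`. -/
def q (s : Fin m) (p : Pt) : ℂ := (d.Phi p ᵥ* d.P) s

/-- `v_0 = 2 (φ Δ⁻¹ φ^*)_x`. -/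
def v : Pt → ℂ := fun p => 2 * dX (fun r => (d.phi r ᵥ* (d.Delta r)⁻¹) ⬝ᵥ star (d.phi r)) p

/-- The entrywise derivative `(Δ⁻¹)_y`. -/
def invDeltaY (p : Pt) : Matrix d.Idx d.Idx ℂ :=
  Matrix.of fun a b => dY (fun r => (d.Delta r)⁻¹ a b) p

/-- `S = 2 P^* (Δ⁻¹)_y P`. -/
def S (i j : Fin m) (p : Pt) : ℂ := ((2 : ℂ) • (d.Pᴴ * d.invDeltaY p * d.P)) i j

/-- The bordered determinant `det [[Δ, u], [w, 0]]`, with a column `u` and a row `w`. -/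
def bordered (p : Pt) (u w : d.Idx → ℂ) : ℂ :=
  (Matrix.fromBlocks (d.Delta p) (Matrix.replicateCol Unit u)
    (Matrix.replicateRow Unit w) (0 : Matrix Unit Unit ℂ)).det

/-- The set where `Δ` is invertible. -/
def regularSet : Set Pt := {p | (d.Delta p).det ≠ 0}

end Params

/-- The parameters with `m = 1` and `K = K_1 = 1`. -/
def oneParams (α : ℂ) (c μ₁ : ℝ) (lam₁ nu₁ : ℂ) : Params 1 where
  K := fun _ => 1
  α := α
  c := c
  μ := fun _ => μ₁
  lam := fun _ => lam₁
  nu := fun _ => nu₁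

/-- The phase `θ` of the one-soliton. -/
def theta (α : ℂ) (c : ℝ) (lam₁ nu₁ : ℂ) (p : Pt) : ℂ :=
  (nu₁ ^ 2 + (c : ℂ) * lam₁ ^ 2) / α * (p.2.2 : ℂ) + nu₁ * (p.1 : ℂ) + lam₁ * (p.2.1 : ℂ)

/-- The denominator `Δ` of the one-soliton, a real function. -/
def oneDelta (α : ℂ) (c μ₁ : ℝ) (lam₁ nu₁ : ℂ) (p : Pt) : ℝ :=
  μ₁ / (2 * lam₁.re) + 1 / (2 * nu₁.re) * Real.exp (2 * (theta α c lam₁ nu₁ p).re)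

/-- The component `q` of the one-soliton. -/
def oneQ (α : ℂ) (c μ₁ : ℝ) (lam₁ nu₁ : ℂ) (p : Pt) : ℂ :=
  Complex.exp (theta α c lam₁ nu₁ p) / (oneDelta α c μ₁ lam₁ nu₁ p : ℂ)

/-- The component `S` of the one-soliton. -/
def oneS (α : ℂ) (c μ₁ : ℝ) (lam₁ nu₁ : ℂ) (p : Pt) : ℂ :=
  ((-2 * (lam₁.re * Real.exp (2 * (theta α c lam₁ nu₁ p).re)
    / (nu₁.re * oneDelta α c μ₁ lam₁ nu₁ p ^ 2)) : ℝ) : ℂ)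

/-- The component `v_0` of the one-soliton. -/
def oneV (α : ℂ) (c μ₁ : ℝ) (lam₁ nu₁ : ℂ) (p : Pt) : ℂ :=
  ((2 * μ₁ * (nu₁.re * Real.exp (2 * (theta α c lam₁ nu₁ p).re)
    / (lam₁.re * oneDelta α c μ₁ lam₁ nu₁ p ^ 2)) : ℝ) : ℂ)

end VectorDS

end

namespace VectorDS

/-! ### Partial derivatives -/

/-! Write R = Δ⁻¹, G for `gram`, N = diag ν, L = diag λ, and N*, L* for their conjugates. Everything
rests on two Sylvester identities: N*G + GN = W := φ*φ (`gram_eq_rankOne`) and L*C + CL = T := ∑ μ_s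
P_s P_s* (`C_eq_signMatrix`). Hence Δ_x = W, Y := Δ_y = L*Δ + ΔL − T, and, because α is imaginary,
αΔ_t = (WN − N*W) + c(YL − L*Y).

With R' = −RΔ'R, every term of the equation for q_i becomes a matrix placed between φ and P_i. The
x-part is then an identity in an arbitrary ring (`x_part_identity`); the y-part also needs RYR = RL*
+ LR − RTR (`y_part_identity`). Since W and T are sums of rank-one matrices, forms containing them
split into the scalar products v q_i and ∑ μ_j q_j S_ji. The other two equations are
cross-differentiations: u = φRφ* satisfies 2u_x = v and u_y = ∑ μ_j|q_j|², while w = P_j*RP_i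
satisfies 2w_y = S_ji and w_x = −conj(q_j) q_i.

For regularity with μ = 1, the form of Δ at x is the Cauchy form of λ at x plus that of ν at φx. A
Cauchy matrix with nodes in the right half-plane is the Gram matrix of the exponentials e^{−z_j s}
in L²(0,∞), hence positive semidefinite, and its null vectors sum to zero over equal nodes. A kernel
vector of Δ is split by the sign of Re λ; as Δ is Hermitian, definite signs force both parts to be
null. `FibreNull.eq_zero` then excludes null vectors, even with repeated nodes, as soon as det Δ is
nonzero at one point. -/

theorem hasDerivAt_slice_x (p : Pt) :
    HasDerivAt (fun s : ℝ => ((s, p.2.1, p.2.2) : Pt)) ((1, 0, 0) : Pt) p.1 :=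
  (hasDerivAt_id p.1).prodMk (hasDerivAt_const p.1 (p.2.1, p.2.2))

theorem hasDerivAt_slice_y (p : Pt) :
    HasDerivAt (fun s : ℝ => ((p.1, s, p.2.2) : Pt)) ((0, 1, 0) : Pt) p.2.1 :=
  (hasDerivAt_const p.2.1 p.1).prodMk ((hasDerivAt_id p.2.1).prodMk (hasDerivAt_const p.2.1 p.2.2))

theorem hasDerivAt_slice_t (p : Pt) :
    HasDerivAt (fun s : ℝ => ((p.1, p.2.1, s) : Pt)) ((0, 0, 1) : Pt) p.2.2 :=
  (hasDerivAt_const p.2.2 p.1).prodMk ((hasDerivAt_const p.2.2 p.2.1).prodMk (hasDerivAt_id p.2.2))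

theorem dX_eq_fderiv {f : Pt → ℂ} {p : Pt} (hf : DifferentiableAt ℝ f p) :
    dX f p = fderiv ℝ f p (1, 0, 0) :=
  (hf.hasFDerivAt.comp_hasDerivAt (f := fun s : ℝ => ((s, p.2.1, p.2.2) : Pt)) p.1
    (hasDerivAt_slice_x p)).deriv

theorem dY_eq_fderiv {f : Pt → ℂ} {p : Pt} (hf : DifferentiableAt ℝ f p) :
    dY f p = fderiv ℝ f p (0, 1, 0) :=
  (hf.hasFDerivAt.comp_hasDerivAt (f := fun s : ℝ => ((p.1, s, p.2.2) : Pt)) p.2.1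
    (hasDerivAt_slice_y p)).deriv

theorem dX_congr {f g : Pt → ℂ} {U : Set Pt} (hU : IsOpen U) (h : Set.EqOn f g U) {p : Pt}
    (hp : p ∈ U) : dX f p = dX g p :=
  Filter.EventuallyEq.deriv_eq <|
    ((hasDerivAt_slice_x p).continuousAt.eventually (hU.mem_nhds hp)).mono fun _ hs => h hs

theorem dY_congr {f g : Pt → ℂ} {U : Set Pt} (hU : IsOpen U) (h : Set.EqOn f g U) {p : Pt}
    (hp : p ∈ U) : dY f p = dY g p :=
  Filter.EventuallyEq.deriv_eq <|
    ((hasDerivAt_slice_y p).continuousAt.eventually (hU.mem_nhds hp)).mono fun _ hs => h hs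

theorem dT_congr {f g : Pt → ℂ} {U : Set Pt} (hU : IsOpen U) (h : Set.EqOn f g U) {p : Pt}
    (hp : p ∈ U) : dT f p = dT g p :=
  Filter.EventuallyEq.deriv_eq <|
    ((hasDerivAt_slice_t p).continuousAt.eventually (hU.mem_nhds hp)).mono fun _ hs => h hs

theorem differentiableAt_of_smoothOn {f : Pt → ℂ} {U : Set Pt} (hU : IsOpen U)
    (hf : ContDiffOn ℝ ∞ f U) {p : Pt} (hp : p ∈ U) : DifferentiableAt ℝ f p :=
  (hf.contDiffAt (hU.mem_nhds hp)).differentiableAt (by simp)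

theorem contDiffOn_fderiv_apply {f : Pt → ℂ} {U : Set Pt} (hU : IsOpen U)
    (hf : ContDiffOn ℝ ∞ f U) (e : Pt) : ContDiffOn ℝ ∞ (fun r => fderiv ℝ f r e) U :=
  (hf.fderiv_of_isOpen hU (m := ∞) (by simp)).clm_apply contDiffOn_const

theorem contDiffOn_dX {f : Pt → ℂ} {U : Set Pt} (hU : IsOpen U) (hf : ContDiffOn ℝ ∞ f U) :
    ContDiffOn ℝ ∞ (dX f) U :=
  (contDiffOn_fderiv_apply hU hf (1, 0, 0)).congr fun _ hp =>
    dX_eq_fderiv (differentiableAt_of_smoothOn hU hf hp)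

theorem contDiffOn_dY {f : Pt → ℂ} {U : Set Pt} (hU : IsOpen U) (hf : ContDiffOn ℝ ∞ f U) :
    ContDiffOn ℝ ∞ (dY f) U :=
  (contDiffOn_fderiv_apply hU hf (0, 1, 0)).congr fun _ hp =>
    dY_eq_fderiv (differentiableAt_of_smoothOn hU hf hp)

/-- Mixed partial derivatives of a smooth function commute. -/
theorem dX_dY_comm {f : Pt → ℂ} {U : Set Pt} (hU : IsOpen U) (hf : ContDiffOn ℝ ∞ f U)
    {p : Pt} (hp : p ∈ U) : dX (dY f) p = dY (dX f) p := by
  have hd : ∀ r ∈ U, DifferentiableAt ℝ f r := fun r hr => differentiableAt_of_smoothOn hU hf hr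
  have hdf : DifferentiableAt ℝ (fderiv ℝ f) p :=
    ((hf.fderiv_of_isOpen hU (m := ∞) (by simp)).contDiffAt
      (hU.mem_nhds hp)).differentiableAt (by simp)
  have hs : IsSymmSndFDerivAt ℝ f p :=
    (hf.contDiffAt (hU.mem_nhds hp)).isSymmSndFDerivAt 
      (by simpa using WithTop.coe_le_coe.2 (le_top : (2 : ℕ∞) ≤ ⊤))
  have key : ∀ e e' : Pt, fderiv ℝ (fun r => fderiv ℝ f r e) p e' = fderiv ℝ (fderiv ℝ f) p e' e := by
    intro e e'
    rw [fderiv_clm_apply hdf (differentiableAt_const e)]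
    simp
  rw [dX_congr hU (fun r hr => dY_eq_fderiv (hd r hr)) hp,
    dY_congr hU (fun r hr => dX_eq_fderiv (hd r hr)) hp,
    dX_eq_fderiv (differentiableAt_of_smoothOn hU (contDiffOn_fderiv_apply hU hf _) hp),
    dY_eq_fderiv (differentiableAt_of_smoothOn hU (contDiffOn_fderiv_apply hU hf _) hp),
    key, key, hs]

theorem dX_const_mul (c : ℂ) {f : Pt → ℂ} {p : Pt} : dX (fun r => c * f r) p = c * dX f p :=
  deriv_const_mul_field c

theorem dY_const_mul (c : ℂ) {f : Pt → ℂ} {p : Pt} : dY (fun r => c * f r) p = c * dY f p :=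
  deriv_const_mul_field c

/-! ### Smooth matrix functions -/

section Smooth

variable {E : Type*} [NormedAddCommGroup E] [NormedSpace ℝ E] {ι : Type*} [Fintype ι]
  [DecidableEq ι]

theorem contDiffOn_det {F : E → Matrix ι ι ℂ} {U : Set E}
    (hF : ∀ i j, ContDiffOn ℝ ∞ (fun r => F r i j) U) : ContDiffOn ℝ ∞ (fun r => (F r).det) U := by
  simp only [Matrix.det_apply]
  refine ContDiffOn.sum fun σ _ => ContDiffOn.const_smul _ ?_
  exact contDiffOn_prod fun i _ => hF _ _

theorem contDiffOn_inv_apply {F : E → Matrix ι ι ℂ} {U : Set E}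
    (hF : ∀ i j, ContDiffOn ℝ ∞ (fun r => F r i j) U) (h0 : ∀ r ∈ U, (F r).det ≠ 0) (i j : ι) :
    ContDiffOn ℝ ∞ (fun r => (F r)⁻¹ i j) U := by
  -- Cramer's rule reduces smoothness of the inverse to smoothness of determinants.
  have : ∀ r, (F r)⁻¹ i j = ((F r).det)⁻¹ * ((F r).updateRow j (Pi.single i 1)).det := by
    intro r
    rw [Matrix.inv_def, Ring.inverse_eq_inv', Matrix.smul_apply, Matrix.adjugate_apply, smul_eq_mul]
  simp only [this]
  refine ((contDiffOn_det hF).inv h0).mul (contDiffOn_det fun a b => ?_)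
  by_cases h : a = j
  · subst h
    simpa using contDiffOn_const
  · simpa [Matrix.updateRow_ne h] using hF a b

end Smooth

/-! ### Entrywise derivatives of matrix functions of one variable -/

/-- `F'` is the entrywise derivative of the matrix function `F` at `s`. -/
def HasMatDerivAt {ι κ : Type*} (F : ℝ → Matrix ι κ ℂ) (F' : Matrix ι κ ℂ) (s : ℝ) : Prop :=
  ∀ i j, HasDerivAt (fun r => F r i j) (F' i j) s

namespace HasMatDerivAt

variable {ι κ τ : Type*} {F G : ℝ → Matrix ι κ ℂ} {F' G' : Matrix ι κ ℂ} {s : ℝ}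

theorem const (A : Matrix ι κ ℂ) (s : ℝ) : HasMatDerivAt (fun _ => A) 0 s :=
  fun i j => hasDerivAt_const s (A i j)

theorem add (hF : HasMatDerivAt F F' s) (hG : HasMatDerivAt G G' s) :
    HasMatDerivAt (fun r => F r + G r) (F' + G') s := fun i j => (hF i j).add (hG i j)

theorem sub (hF : HasMatDerivAt F F' s) (hG : HasMatDerivAt G G' s) :
    HasMatDerivAt (fun r => F r - G r) (F' - G') s := fun i j => (hF i j).sub (hG i j)

theorem mul [Fintype κ] {H : ℝ → Matrix κ τ ℂ} {H' : Matrix κ τ ℂ} (hF : HasMatDerivAt F F' s)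
    (hH : HasMatDerivAt H H' s) :
    HasMatDerivAt (fun r => F r * H r) (F' * H s + F s * H') s := by
  intro i j
  simp only [Matrix.mul_apply, Matrix.add_apply, ← Finset.sum_add_distrib]
  exact HasDerivAt.fun_sum fun k _ => (hF i k).mul (hH k j)

theorem const_mul [Fintype ι] (A : Matrix τ ι ℂ) (hF : HasMatDerivAt F F' s) :
    HasMatDerivAt (fun r => A * F r) (A * F') s := by
  simpa using (const A s).mul hF

theorem mul_const [Fintype κ] (A : Matrix κ τ ℂ) (hF : HasMatDerivAt F F' s) :
    HasMatDerivAt (fun r => F r * A) (F' * A) s := by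
  simpa using hF.mul (const A s)

theorem unique (hF : HasMatDerivAt F F' s) (hG : HasMatDerivAt F G' s) : F' = G' := by
  ext i j
  exact (hF i j).unique (hG i j)

theorem congr (hF : HasMatDerivAt F F' s) (h : G =ᶠ[nhds s] F) : HasMatDerivAt G F' s :=
  fun i j => (hF i j).congr_of_eventuallyEq (h.mono fun r hr => by simp only [hr])

/-- Derivative of the inverse of a matrix function. -/
theorem inv [Fintype ι] [DecidableEq ι] {D : ℝ → Matrix ι ι ℂ} {D' : Matrix ι ι ℂ}
    (hD : HasMatDerivAt D D' s) (h0 : ∀ᶠ r in nhds s, (D r).det ≠ 0)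
    (hR : ∀ i j, DifferentiableAt ℝ (fun r => (D r)⁻¹ i j) s) :
    HasMatDerivAt (fun r => (D r)⁻¹) (-((D s)⁻¹ * D' * (D s)⁻¹)) s := by
  obtain ⟨R', hR'⟩ : ∃ R', HasMatDerivAt (fun r => (D r)⁻¹) R' s :=
    ⟨Matrix.of fun i j => deriv (fun r => (D r)⁻¹ i j) s, fun i j => (hR i j).hasDerivAt⟩
  -- Existence of R' comes from `hR`; differentiating D D⁻¹ = 1 then determines its value.
  have h1 : HasMatDerivAt (fun r => D r * (D r)⁻¹) 0 s :=
    (const (1 : Matrix ι ι ℂ) s).congr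
      (h0.mono fun r hr => Matrix.mul_nonsing_inv _ (isUnit_iff_ne_zero.2 hr))
  have h2 := (hD.mul hR').unique h1
  have h3 : (D s)⁻¹ * D s = 1 := Matrix.nonsing_inv_mul _ (isUnit_iff_ne_zero.2 h0.self_of_nhds)
  have h4 : R' = -((D s)⁻¹ * D' * (D s)⁻¹) := by
    have h5 : (D s)⁻¹ * (D' * (D s)⁻¹ + D s * R') = 0 := by rw [h2, Matrix.mul_zero]
    rw [Matrix.mul_add, ← Matrix.mul_assoc, ← Matrix.mul_assoc, h3, Matrix.one_mul] at h5
    exact eq_neg_of_add_eq_zero_right h5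
  exact h4 ▸ hR'

end HasMatDerivAt

/-- Product rule for `φ X w`, when `φ` is multiplied entrywise by `a` under differentiation. -/
theorem HasMatDerivAt.vecMul_dotProduct {ι : Type*} [Fintype ι] [DecidableEq ι]
    {φ w : ℝ → ι → ℂ} {a : ι → ℂ} {b : ι → ℂ} {X : ℝ → Matrix ι ι ℂ} {X' : Matrix ι ι ℂ} {s : ℝ}
    (hφ : ∀ j, HasDerivAt (fun r => φ r j) (a j * φ s j) s)
    (hw : ∀ j, HasDerivAt (fun r => w r j) (b j * w s j) s) (hX : HasMatDerivAt X X' s) :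
    HasDerivAt (fun r => φ r ⬝ᵥ X r *ᵥ w r)
      (φ s ⬝ᵥ (Matrix.diagonal a * X s + X' + X s * Matrix.diagonal b) *ᵥ w s) s := by
  have e : ∀ (u v : ι → ℂ) (Z : Matrix ι ι ℂ),
      u ⬝ᵥ Z *ᵥ v = ∑ i, ∑ j, u i * Z i j * v j := fun u v Z => by
    simp only [dotProduct, Matrix.mulVec, Finset.mul_sum, mul_assoc]
  simp only [e]
  refine HasDerivAt.fun_sum fun i _ => HasDerivAt.fun_sum fun j _ => ?_
  refine (((hφ i).mul (hX i j)).mul (hw j)).congr_deriv ?_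
  simp only [Matrix.add_apply, Matrix.diagonal_mul, Matrix.mul_diagonal, Pi.mul_apply]
  ring

/-! ### Identities in the matrix ring -/

section Algebra

variable {A : Type*} [Ring A]

/-- In the application R = Δ⁻¹, W = φ*φ and N, N' are diag ν and its conjugate, with R_x = −RWR and
W_x = N'W + WN already substituted. The left side is the ν-part of α q_t; on the right stand q_xx
and, as the doubled term, v q. No relation among the letters is needed. -/
theorem x_part_identity (N N' R W : A) :
    N * N * R - R * (W * N - N' * W) * R =
      N * (N * R - R * W * R) + (N * -(R * W * R) - (-(R * W * R) * W * R +
          R * ((N' * W + W * N) * R + W * -(R * W * R))))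
        + 2 * ((N * R + -(R * W * R) + R * N') * W * R) := by
  noncomm_ring

/-- The analogue in y, with Y = Δ_y and T = ∑ μ_s P_s P_s*. The two sides differ by −2(RYR − RL' −
LR + RTR)YR, so the Sylvester relation `h`, multiplied on the right by YR, is exactly what is
missing. -/
theorem y_part_identity (L L' R Y T : A) (h : R * Y * R = R * L' + L * R - R * T * R) :
    L * L * R - R * (Y * L - L' * Y) * R =
      L * (L * R - R * Y * R) + (L * -(R * Y * R) - (-(R * Y * R) * Y * R +
          R * ((L' * Y + Y * L) * R + Y * -(R * Y * R))))
        - 2 * (R * T * -(R * Y * R)) := by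
  have h2 : R * Y * R * (Y * R) = (R * L' + L * R - R * T * R) * (Y * R) := by rw [h]
  rw [← sub_eq_zero] at h2 ⊢
  calc _ = -(2 * (R * Y * R * (Y * R) - (R * L' + L * R - R * T * R) * (Y * R))) := by
        noncomm_ring
    _ = 0 := by rw [h2]; simp

end Algebra

/-- A rank-one factor cuts a bilinear form into a product of two scalars; this is the source of the
nonlinear terms. -/
theorem dotProduct_mul_vecMulVec_mul_mulVec {ι : Type*} [Fintype ι] (u b c w : ι → ℂ)
    (X Y : Matrix ι ι ℂ) :
    u ⬝ᵥ (X * Matrix.vecMulVec b c * Y) *ᵥ w = (u ⬝ᵥ X *ᵥ b) * (c ⬝ᵥ Y *ᵥ w) := by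
  rw [← Matrix.mulVec_mulVec, ← Matrix.mulVec_mulVec, Matrix.vecMulVec_mulVec, Matrix.mulVec_smul,
    dotProduct_smul]
  simp

namespace Params

variable {m : ℕ} (d : Params m)

/-! ### The exponentials and the matrix `Δ` -/

theorem hasDerivAt_phi_x (p : Pt) (j : d.Idx) :
    HasDerivAt (fun s : ℝ => d.phi (s, p.2.1, p.2.2) j) (d.nu j * d.phi p j) p.1 := by
  simp only [phi]
  have h : HasDerivAt (fun s : ℝ => (s : ℂ)) 1 p.1 := Complex.ofRealCLM.hasDerivAt
  refine ((((h.const_mul (d.nu j)).const_add _).add_const _).cexp).congr_deriv ?_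
  ring

theorem hasDerivAt_phi_y (p : Pt) (j : d.Idx) :
    HasDerivAt (fun s : ℝ => d.phi (p.1, s, p.2.2) j) (d.lam j * d.phi p j) p.2.1 := by
  simp only [phi]
  have h : HasDerivAt (fun s : ℝ => (s : ℂ)) 1 p.2.1 := Complex.ofRealCLM.hasDerivAt
  refine (((h.const_mul (d.lam j)).const_add _).cexp).congr_deriv ?_
  ring

theorem hasDerivAt_phi_t (p : Pt) (j : d.Idx) :
    HasDerivAt (fun s : ℝ => d.phi (p.1, p.2.1, s) j)
      ((d.nu j ^ 2 + (d.c : ℂ) * d.lam j ^ 2) / d.α * d.phi p j) p.2.2 := by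
  simp only [phi]
  have h : HasDerivAt (fun s : ℝ => (s : ℂ)) 1 p.2.2 := Complex.ofRealCLM.hasDerivAt
  refine ((((h.const_mul ((d.nu j ^ 2 + (d.c : ℂ) * d.lam j ^ 2) / d.α)).add_const _).add_const
    _).cexp).congr_deriv ?_
  ring

theorem contDiff_phi (j : d.Idx) : ContDiff ℝ ∞ (fun r => d.phi r j) := by
  have h : ContDiff ℝ ∞ (fun s : ℝ => (s : ℂ)) := Complex.ofRealCLM.contDiff
  unfold phi
  refine ContDiff.cexp ?_
  refine ((contDiff_const.mul (h.comp (contDiff_snd.comp contDiff_snd))).add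
    (contDiff_const.mul (h.comp contDiff_fst))).add
    (contDiff_const.mul (h.comp (contDiff_fst.comp contDiff_snd)))

theorem contDiff_star_phi (j : d.Idx) : ContDiff ℝ ∞ (fun r => star (d.phi r j)) :=
  (Complex.conjCLE : ℂ →L[ℝ] ℂ).contDiff.comp (d.contDiff_phi j)

theorem contDiff_Delta (i j : d.Idx) : ContDiff ℝ ∞ (fun r => d.Delta r i j) := by
  simp only [Delta, gram, Matrix.add_apply, Matrix.of_apply]
  exact contDiff_const.add (((d.contDiff_star_phi i).mul (d.contDiff_phi j)).div_const _)

theorem isOpen_regularSet : IsOpen d.regularSet := by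
  have h : Continuous fun r => (d.Delta r).det :=
    Continuous.matrix_det (continuous_matrix fun i j => (d.contDiff_Delta i j).continuous)
  exact isOpen_ne_fun h continuous_const

theorem contDiffOn_inv_Delta (i j : d.Idx) :
    ContDiffOn ℝ ∞ (fun r => (d.Delta r)⁻¹ i j) d.regularSet :=
  contDiffOn_inv_apply (fun a b => (d.contDiff_Delta a b).contDiffOn) (fun _ h => h) i j

/-- The rank-one matrix `φ^* φ`. -/
noncomputable def rankOne (p : Pt) : Matrix d.Idx d.Idx ℂ := Matrix.vecMulVec (star (d.phi p)) (d.phi p)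

/-- The `s`-th column of `P`. -/
noncomputable def col (s : Fin m) (a : d.Idx) : ℂ := d.P a s

/-- The matrix `∑ μ_s P_s P_s^*`. -/
noncomputable def signMatrix : Matrix d.Idx d.Idx ℂ :=
  ∑ s, (d.μ s : ℂ) • Matrix.vecMulVec (d.col s) (star (d.col s))

/-- The matrix `Δ_y`. -/
noncomputable def DeltaY (p : Pt) : Matrix d.Idx d.Idx ℂ :=
  Matrix.diagonal (star d.lam) * d.gram p + d.gram p * Matrix.diagonal d.lam

variable {d}

/-- The left side multiplies the entry (i, j) by ν_j + conj ν_i, which is its denominator. -/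
theorem gram_eq_rankOne (hd : d.Admissible) (p : Pt) :
    Matrix.diagonal (star d.nu) * d.gram p + d.gram p * Matrix.diagonal d.nu = d.rankOne p := by
  ext i j
  have := hd.nu_ne i j
  simp only [gram, rankOne, Matrix.add_apply, Matrix.diagonal_mul, Matrix.mul_diagonal,
    Matrix.of_apply, Matrix.vecMulVec_apply, Pi.star_apply]
  field_simp
  ring

/-- The same cancellation of denominators inside each block; between different blocks both sides
vanish, since no column of P is supported on two blocks. -/
theorem C_eq_signMatrix (hd : d.Admissible) :
    Matrix.diagonal (star d.lam) * d.C + d.C * Matrix.diagonal d.lam = d.signMatrix := by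
  ext ⟨s, i⟩ ⟨t, j⟩
  simp only [C, signMatrix, Matrix.add_apply, Matrix.diagonal_mul, Matrix.mul_diagonal,
    Matrix.sum_apply, Matrix.smul_apply, Matrix.vecMulVec_apply, col, P, Pi.star_apply,
    Matrix.of_apply, smul_eq_mul]
  by_cases h : s = t
  · subst h
    have := hd.lam_ne s i j
    simp only [Matrix.blockDiagonal'_apply_eq, Matrix.of_apply]
    rw [Finset.sum_eq_single s (fun b _ hb => by simp [hb.symm]) (by simp)]
    simp only [if_true, star_one]
    field_simp
    ring
  · rw [Matrix.blockDiagonal'_apply_ne _ _ _ h, Finset.sum_eq_zero]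
    · simp
    · intro b _
      by_cases hb : s = b
      · subst hb
        simp [Ne.symm h]
      · simp [hb]

theorem DeltaY_eq (hd : d.Admissible) (p : Pt) :
    d.DeltaY p = Matrix.diagonal (star d.lam) * d.Delta p + d.Delta p * Matrix.diagonal d.lam
      - d.signMatrix := by
  rw [← C_eq_signMatrix hd, DeltaY, Delta]
  noncomm_ring

variable (d)

theorem C_conjTranspose : d.Cᴴ = d.C := by
  ext ⟨s, i⟩ ⟨t, j⟩
  rw [Matrix.conjTranspose_apply, C]
  by_cases h : s = t
  · subst h
    simp [Matrix.blockDiagonal'_apply_eq, add_comm]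
  · rw [Matrix.blockDiagonal'_apply_ne _ _ _ h, Matrix.blockDiagonal'_apply_ne _ _ _ (Ne.symm h),
      star_zero]

theorem gram_conjTranspose (p : Pt) : (d.gram p)ᴴ = d.gram p := by
  ext i j
  simp [Matrix.conjTranspose_apply, gram, add_comm, mul_comm]

theorem Delta_conjTranspose (p : Pt) : (d.Delta p)ᴴ = d.Delta p := by
  rw [Delta, Matrix.conjTranspose_add, C_conjTranspose, gram_conjTranspose]

/-! ### Derivatives along curves -/

section Curve

variable {γ : ℝ → Pt} {s : ℝ} {a : d.Idx → ℂ}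

theorem hasDerivAt_star_phi
    (hφ : ∀ j, HasDerivAt (fun r => d.phi (γ r) j) (a j * d.phi (γ s) j) s) (j : d.Idx) :
    HasDerivAt (fun r => star (d.phi (γ r)) j) (star a j * star (d.phi (γ s)) j) s := by
  refine (hφ j).star.congr_deriv ?_
  simp

/-- Along each coordinate line φ is differentiated by entrywise multiplication with a constant
vector a, namely ν, λ or (ν² + cλ²)/α. Treating a general a gives all three partial derivatives at
once. -/
theorem hasMatDerivAt_gram
    (hφ : ∀ j, HasDerivAt (fun r => d.phi (γ r) j) (a j * d.phi (γ s) j) s) :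
    HasMatDerivAt (fun r => d.gram (γ r))
      (Matrix.diagonal (star a) * d.gram (γ s) + d.gram (γ s) * Matrix.diagonal a) s := by
  intro i j
  refine (((d.hasDerivAt_star_phi hφ i).mul (hφ j)).div_const _).congr_deriv ?_
  simp only [gram, Matrix.add_apply, Matrix.diagonal_mul, Matrix.mul_diagonal, Matrix.of_apply,
    Pi.star_apply]
  ring

theorem hasMatDerivAt_Delta
    (hφ : ∀ j, HasDerivAt (fun r => d.phi (γ r) j) (a j * d.phi (γ s) j) s) :
    HasMatDerivAt (fun r => d.Delta (γ r))
      (Matrix.diagonal (star a) * d.gram (γ s) + d.gram (γ s) * Matrix.diagonal a) s := by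
  have h := (HasMatDerivAt.const d.C s).add (d.hasMatDerivAt_gram hφ)
  rwa [zero_add] at h

theorem hasMatDerivAt_inv_Delta
    (hφ : ∀ j, HasDerivAt (fun r => d.phi (γ r) j) (a j * d.phi (γ s) j) s)
    (hγ : DifferentiableAt ℝ γ s) (hs : γ s ∈ d.regularSet) :
    HasMatDerivAt (fun r => (d.Delta (γ r))⁻¹)
      (-((d.Delta (γ s))⁻¹ * (Matrix.diagonal (star a) * d.gram (γ s) +
        d.gram (γ s) * Matrix.diagonal a) * (d.Delta (γ s))⁻¹)) s := by
  refine (d.hasMatDerivAt_Delta hφ).inv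
    (hγ.continuousAt.eventually (d.isOpen_regularSet.mem_nhds hs)) fun i j => ?_
  exact (differentiableAt_of_smoothOn d.isOpen_regularSet (d.contDiffOn_inv_Delta i j) hs).comp s hγ

/-- The first x- and y-derivatives of q carry a matrix of the shape BR − RZR; this provides the
second derivatives. -/
theorem hasMatDerivAt_sandwich {Z R : ℝ → Matrix d.Idx d.Idx ℂ} {Z' R' : Matrix d.Idx d.Idx ℂ}
    (hR : HasMatDerivAt R R' s) (hZ : HasMatDerivAt Z Z' s) (B : Matrix d.Idx d.Idx ℂ) :
    HasMatDerivAt (fun r => B * R r - R r * Z r * R r)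
      (B * R' - (R' * Z s * R s + R s * (Z' * R s + Z s * R'))) s := by
  convert (hR.const_mul B).sub ((hR.mul hZ).mul hR) using 1
  noncomm_ring

theorem hasMatDerivAt_rankOne (hd : d.Admissible)
    (hφ : ∀ j, HasDerivAt (fun r => d.phi (γ r) j) (d.nu j * d.phi (γ s) j) s) :
    HasMatDerivAt (fun r => d.rankOne (γ r))
      (Matrix.diagonal (star d.nu) * d.rankOne (γ s) + d.rankOne (γ s) * Matrix.diagonal d.nu)
      s := by
  have h := d.hasMatDerivAt_gram hφ
  simp only [← gram_eq_rankOne hd]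
  exact (h.const_mul _).add (h.mul_const _)

theorem hasMatDerivAt_DeltaY
    (hφ : ∀ j, HasDerivAt (fun r => d.phi (γ r) j) (d.lam j * d.phi (γ s) j) s) :
    HasMatDerivAt (fun r => d.DeltaY (γ r))
      (Matrix.diagonal (star d.lam) * d.DeltaY (γ s) + d.DeltaY (γ s) * Matrix.diagonal d.lam)
      s := by
  have h := d.hasMatDerivAt_gram hφ
  exact (h.const_mul _).add (h.mul_const _)

/-- Product rule for `φ X w` with a constant vector `w`. -/
theorem hasDerivAt_phi_form
    (hφ : ∀ j, HasDerivAt (fun r => d.phi (γ r) j) (a j * d.phi (γ s) j) s)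
    {X : ℝ → Matrix d.Idx d.Idx ℂ} {X' : Matrix d.Idx d.Idx ℂ} (hX : HasMatDerivAt X X' s)
    (w : d.Idx → ℂ) :
    HasDerivAt (fun r => d.phi (γ r) ⬝ᵥ X r *ᵥ w)
      (d.phi (γ s) ⬝ᵥ (Matrix.diagonal a * X s + X') *ᵥ w) s := by
  refine (HasMatDerivAt.vecMul_dotProduct (w := fun _ => w) (b := 0) hφ
    (fun j => by simpa using hasDerivAt_const s (w j)) hX).congr_deriv ?_
  simp

end Curve

end Params

namespace Params

variable {m : ℕ} (d : Params m)

/-! ### The solution in terms of `Δ⁻¹` -/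

/-- The scalar `φ Δ⁻¹ φ^*`. -/
noncomputable def potential (p : Pt) : ℂ := d.phi p ⬝ᵥ (d.Delta p)⁻¹ *ᵥ star (d.phi p)

theorem q_eq (i : Fin m) (p : Pt) : d.q i p = d.phi p ⬝ᵥ (d.Delta p)⁻¹ *ᵥ d.col i := by
  rw [Matrix.dotProduct_mulVec]
  rfl

theorem v_eq (p : Pt) : d.v p = 2 * dX d.potential p := by
  have : d.potential = fun r => (d.phi r ᵥ* (d.Delta r)⁻¹) ⬝ᵥ star (d.phi r) := by
    funext r
    rw [potential, Matrix.dotProduct_mulVec]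
  rw [this]
  rfl

theorem S_eq (i j : Fin m) (p : Pt) :
    d.S i j p = 2 * (star (d.col i) ⬝ᵥ d.invDeltaY p *ᵥ d.col j) := by
  rw [Matrix.dotProduct_mulVec]
  rfl

theorem contDiffOn_form {x y : Pt → d.Idx → ℂ} (hx : ∀ j, ContDiff ℝ ∞ (fun r => x r j))
    (hy : ∀ j, ContDiff ℝ ∞ (fun r => y r j)) :
    ContDiffOn ℝ ∞ (fun r => x r ⬝ᵥ (d.Delta r)⁻¹ *ᵥ y r) d.regularSet := by
  simp only [dotProduct, Matrix.mulVec]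
  exact ContDiffOn.sum fun i _ => (hx i).contDiffOn.mul
    (ContDiffOn.sum fun j _ => (d.contDiffOn_inv_Delta i j).mul (hy j).contDiffOn)

theorem contDiffOn_q (i : Fin m) : ContDiffOn ℝ ∞ (d.q i) d.regularSet :=
  (d.contDiffOn_form d.contDiff_phi (y := fun _ => d.col i) fun _ => contDiff_const).congr
    fun p _ => d.q_eq i p

theorem contDiffOn_potential : ContDiffOn ℝ ∞ d.potential d.regularSet :=
  d.contDiffOn_form d.contDiff_phi d.contDiff_star_phi

theorem contDiffOn_v : ContDiffOn ℝ ∞ d.v d.regularSet :=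
  (contDiffOn_const.mul (contDiffOn_dX d.isOpen_regularSet d.contDiffOn_potential)).congr
    fun p _ => d.v_eq p

/-- The scalar `P_i^* Δ⁻¹ P_j`. -/
noncomputable def colForm (i j : Fin m) (p : Pt) : ℂ :=
  star (d.col i) ⬝ᵥ (d.Delta p)⁻¹ *ᵥ d.col j

theorem contDiffOn_colForm (i j : Fin m) : ContDiffOn ℝ ∞ (d.colForm i j) d.regularSet :=
  d.contDiffOn_form (x := fun _ => star (d.col i)) (y := fun _ => d.col j)
    (fun _ => contDiff_const) fun _ => contDiff_const

variable {d}

theorem hasMatDerivAt_inv_Delta_x (hd : d.Admissible) {p : Pt} (hp : p ∈ d.regularSet) :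
    HasMatDerivAt (fun s => (d.Delta (s, p.2.1, p.2.2))⁻¹)
      (-((d.Delta p)⁻¹ * d.rankOne p * (d.Delta p)⁻¹)) p.1 := by
  rw [← gram_eq_rankOne hd]
  exact d.hasMatDerivAt_inv_Delta (d.hasDerivAt_phi_x p) (hasDerivAt_slice_x p).differentiableAt hp

theorem hasMatDerivAt_inv_Delta_y {p : Pt} (hp : p ∈ d.regularSet) :
    HasMatDerivAt (fun s => (d.Delta (p.1, s, p.2.2))⁻¹)
      (-((d.Delta p)⁻¹ * d.DeltaY p * (d.Delta p)⁻¹)) p.2.1 :=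
  d.hasMatDerivAt_inv_Delta (d.hasDerivAt_phi_y p) (hasDerivAt_slice_y p).differentiableAt hp

theorem invDeltaY_eq {p : Pt} (hp : p ∈ d.regularSet) :
    d.invDeltaY p = -((d.Delta p)⁻¹ * d.DeltaY p * (d.Delta p)⁻¹) := by
  ext i j
  exact (hasMatDerivAt_inv_Delta_y hp i j).deriv

theorem dX_q (hd : d.Admissible) {p : Pt} (hp : p ∈ d.regularSet) (i : Fin m) :
    dX (d.q i) p = d.phi p ⬝ᵥ (Matrix.diagonal d.nu * (d.Delta p)⁻¹ -
      (d.Delta p)⁻¹ * d.rankOne p * (d.Delta p)⁻¹) *ᵥ d.col i := by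
  rw [show d.q i = fun r => d.phi r ⬝ᵥ (d.Delta r)⁻¹ *ᵥ d.col i from funext (d.q_eq i),
    sub_eq_add_neg]
  exact (d.hasDerivAt_phi_form (d.hasDerivAt_phi_x p) (hasMatDerivAt_inv_Delta_x hd hp) _).deriv

theorem dY_q {p : Pt} (hp : p ∈ d.regularSet) (i : Fin m) :
    dY (d.q i) p = d.phi p ⬝ᵥ (Matrix.diagonal d.lam * (d.Delta p)⁻¹ -
      (d.Delta p)⁻¹ * d.DeltaY p * (d.Delta p)⁻¹) *ᵥ d.col i := by
  rw [show d.q i = fun r => d.phi r ⬝ᵥ (d.Delta r)⁻¹ *ᵥ d.col i from funext (d.q_eq i),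
    sub_eq_add_neg]
  exact (d.hasDerivAt_phi_form (d.hasDerivAt_phi_y p) (hasMatDerivAt_inv_Delta_y hp) _).deriv

theorem dX_dX_q (hd : d.Admissible) {p : Pt} (hp : p ∈ d.regularSet) (i : Fin m)
    {R W N N' : Matrix d.Idx d.Idx ℂ} (hR : R = (d.Delta p)⁻¹) (hW : W = d.rankOne p)
    (hN : N = Matrix.diagonal d.nu) (hN' : N' = Matrix.diagonal (star d.nu)) :
    dX (dX (d.q i)) p = d.phi p ⬝ᵥ (N * (N * R - R * W * R) + (N * -(R * W * R) -
      (-(R * W * R) * W * R + R * ((N' * W + W * N) * R + W * -(R * W * R))))) *ᵥ d.col i := by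
  rw [dX_congr d.isOpen_regularSet (fun r hr => dX_q hd hr i) hp]
  subst hR hW hN hN'
  have h := d.hasMatDerivAt_sandwich (hasMatDerivAt_inv_Delta_x hd hp)
    (d.hasMatDerivAt_rankOne hd (d.hasDerivAt_phi_x p)) (Matrix.diagonal d.nu)
  exact (d.hasDerivAt_phi_form (d.hasDerivAt_phi_x p) h _).deriv

theorem dY_dY_q {p : Pt} (hp : p ∈ d.regularSet) (i : Fin m)
    {R Y L L' : Matrix d.Idx d.Idx ℂ} (hR : R = (d.Delta p)⁻¹) (hY : Y = d.DeltaY p)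
    (hL : L = Matrix.diagonal d.lam) (hL' : L' = Matrix.diagonal (star d.lam)) :
    dY (dY (d.q i)) p = d.phi p ⬝ᵥ (L * (L * R - R * Y * R) + (L * -(R * Y * R) -
      (-(R * Y * R) * Y * R + R * ((L' * Y + Y * L) * R + Y * -(R * Y * R))))) *ᵥ d.col i := by
  rw [dY_congr d.isOpen_regularSet (fun r hr => dY_q hr i) hp]
  subst hR hY hL hL'
  have h := d.hasMatDerivAt_sandwich (hasMatDerivAt_inv_Delta_y hp)
    (d.hasMatDerivAt_DeltaY (d.hasDerivAt_phi_y p)) (Matrix.diagonal d.lam)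
  exact (d.hasDerivAt_phi_form (d.hasDerivAt_phi_y p) h _).deriv

/-- This sign is where α ∈ iℝ enters: it makes αΔ_t a difference of squares. -/
theorem star_div_of_re_eq_zero {a : ℂ} (ha : a.re = 0) (z : ℂ) : star (z / a) = -(star z / a) := by
  have : star a = -a := by
    apply Complex.ext <;> simp [ha]
  rw [star_div₀, this, div_neg]

theorem alpha_mul_dT_q (hd : d.Admissible) {p : Pt} (hp : p ∈ d.regularSet) (i : Fin m)
    {R W Y N N' L L' : Matrix d.Idx d.Idx ℂ} (hR : R = (d.Delta p)⁻¹) (hW : W = d.rankOne p)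
    (hY : Y = d.DeltaY p) (hN : N = Matrix.diagonal d.nu) (hN' : N' = Matrix.diagonal (star d.nu))
    (hL : L = Matrix.diagonal d.lam) (hL' : L' = Matrix.diagonal (star d.lam)) :
    d.α * dT (d.q i) p =
      d.phi p ⬝ᵥ (N * N * R - R * (W * N - N' * W) * R) *ᵥ d.col i
      + (d.c : ℂ) * (d.phi p ⬝ᵥ (L * L * R - R * (Y * L - L' * Y) * R) *ᵥ d.col i) := by
  have hα := hd.α_ne
  set a : d.Idx → ℂ := fun j => (d.nu j ^ 2 + (d.c : ℂ) * d.lam j ^ 2) / d.α with ha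
  have e1 : d.α • Matrix.diagonal a = N * N + (d.c : ℂ) • (L * L) := by
    subst hN hL
    rw [Matrix.diagonal_mul_diagonal, Matrix.diagonal_mul_diagonal, ← Matrix.diagonal_smul,
      ← Matrix.diagonal_smul, Matrix.diagonal_add]
    congr 1
    funext j
    simp only [Pi.smul_apply, smul_eq_mul, ha]
    field_simp
  have e2 : d.α • Matrix.diagonal (star a) = -(N' * N' + (d.c : ℂ) • (L' * L')) := by
    subst hN' hL'
    rw [Matrix.diagonal_mul_diagonal, Matrix.diagonal_mul_diagonal, ← Matrix.diagonal_smul,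
      ← Matrix.diagonal_smul, Matrix.diagonal_add, Matrix.diagonal_neg]
    congr 1
    funext j
    simp only [Pi.smul_apply, smul_eq_mul, ha, Pi.star_apply, star_div_of_re_eq_zero hd.α_re]
    simp only [star_add, star_mul', star_pow, Complex.star_def, Complex.conj_ofReal]
    field_simp
  -- Here GN² − N'²G = (N'G + GN)N − N'(N'G + GN), and likewise for L, so G occurs only through W
  -- and Y.
  have hG : d.α • (Matrix.diagonal (star a) * d.gram p + d.gram p * Matrix.diagonal a) =
      (W * N - N' * W) + (d.c : ℂ) • (Y * L - L' * Y) := by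
    rw [smul_add, ← Matrix.smul_mul, ← Matrix.mul_smul, e1, e2, hW, ← gram_eq_rankOne hd, hY,
      DeltaY, ← hN, ← hN', ← hL, ← hL']
    simp only [Matrix.mul_add, Matrix.add_mul, Matrix.neg_mul, Matrix.smul_mul, Matrix.mul_smul,
      smul_sub, smul_add, Matrix.mul_assoc]
    abel
  have h := (d.hasDerivAt_phi_form (d.hasDerivAt_phi_t p) (d.hasMatDerivAt_inv_Delta
    (d.hasDerivAt_phi_t p) (hasDerivAt_slice_t p).differentiableAt hp) (d.col i)).deriv
  have h' : dT (d.q i) p = d.phi p ⬝ᵥ (Matrix.diagonal a * R + -(R * (Matrix.diagonal (star a) *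
      d.gram p + d.gram p * Matrix.diagonal a) * R)) *ᵥ d.col i := by
    rw [show d.q i = fun r => d.phi r ⬝ᵥ (d.Delta r)⁻¹ *ᵥ d.col i from funext (d.q_eq i), hR]
    exact h
  rw [h', ← smul_eq_mul d.α, ← smul_eq_mul (d.c : ℂ), ← dotProduct_smul, ← dotProduct_smul,
    ← Matrix.smul_mulVec, ← Matrix.smul_mulVec, ← dotProduct_add, ← Matrix.add_mulVec]
  congr 2
  rw [smul_add, smul_neg, ← Matrix.smul_mul, ← Matrix.smul_mul, ← Matrix.mul_smul, hG, e1]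
  simp only [Matrix.mul_add, Matrix.add_mul, Matrix.smul_mul, Matrix.mul_smul]
  rw [smul_sub]
  abel

theorem dX_potential (hd : d.Admissible) {p : Pt} (hp : p ∈ d.regularSet) :
    dX d.potential p = d.phi p ⬝ᵥ (Matrix.diagonal d.nu * (d.Delta p)⁻¹ +
      -((d.Delta p)⁻¹ * d.rankOne p * (d.Delta p)⁻¹) +
      (d.Delta p)⁻¹ * Matrix.diagonal (star d.nu)) *ᵥ star (d.phi p) :=
  (HasMatDerivAt.vecMul_dotProduct (d.hasDerivAt_phi_x p)
    (d.hasDerivAt_star_phi (d.hasDerivAt_phi_x p)) (hasMatDerivAt_inv_Delta_x hd hp)).deriv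

/-- The Sylvester form of Δ_y, multiplied by Δ⁻¹ on both sides. -/
theorem inv_mul_DeltaY_mul_inv (hd : d.Admissible) {p : Pt} (hp : p ∈ d.regularSet) :
    (d.Delta p)⁻¹ * d.DeltaY p * (d.Delta p)⁻¹ =
      (d.Delta p)⁻¹ * Matrix.diagonal (star d.lam) + Matrix.diagonal d.lam * (d.Delta p)⁻¹ -
        (d.Delta p)⁻¹ * d.signMatrix * (d.Delta p)⁻¹ := by
  have h1 : (d.Delta p)⁻¹ * d.Delta p = 1 := Matrix.nonsing_inv_mul _ (isUnit_iff_ne_zero.2 hp)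
  have h2 : d.Delta p * (d.Delta p)⁻¹ = 1 := Matrix.mul_nonsing_inv _ (isUnit_iff_ne_zero.2 hp)
  rw [DeltaY_eq hd]
  simp only [Matrix.mul_sub, Matrix.sub_mul, Matrix.mul_add, Matrix.add_mul, Matrix.mul_assoc, h2,
    Matrix.mul_one]
  rw [← Matrix.mul_assoc (d.Delta p)⁻¹ (d.Delta p), h1, Matrix.one_mul]

variable (d) in
-- Holds because Δ, and with it Δ⁻¹, is Hermitian.
theorem star_q (j : Fin m) (p : Pt) :
    star (d.q j p) = star (d.col j) ⬝ᵥ (d.Delta p)⁻¹ *ᵥ star (d.phi p) := by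
  rw [q_eq, ← Matrix.star_dotProduct_star,
    Matrix.star_mulVec, Matrix.conjTranspose_nonsing_inv, Delta_conjTranspose,
    Matrix.dotProduct_mulVec]

variable (d) in
theorem phi_signMatrix_form (p : Pt) (X : Matrix d.Idx d.Idx ℂ) (w : d.Idx → ℂ) :
    d.phi p ⬝ᵥ ((d.Delta p)⁻¹ * d.signMatrix * X) *ᵥ w =
      ∑ j, (d.μ j : ℂ) * d.q j p * (star (d.col j) ⬝ᵥ X *ᵥ w) := by
  simp only [signMatrix, Matrix.mul_sum, Matrix.sum_mul, Matrix.mul_smul, Matrix.smul_mul,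
    Matrix.sum_mulVec, Matrix.smul_mulVec, dotProduct_sum, dotProduct_smul,
    dotProduct_mul_vecMulVec_mul_mulVec, q_eq, smul_eq_mul]
  exact Finset.sum_congr rfl fun j _ => (mul_assoc _ _ _).symm

theorem dY_potential (hd : d.Admissible) {p : Pt} (hp : p ∈ d.regularSet) :
    dY d.potential p = ∑ j, (d.μ j : ℂ) * ((‖d.q j p‖ ^ 2 : ℝ) : ℂ) := by
  have h := (HasMatDerivAt.vecMul_dotProduct (d.hasDerivAt_phi_y p)
    (d.hasDerivAt_star_phi (d.hasDerivAt_phi_y p)) (hasMatDerivAt_inv_Delta_y hp)).deriv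
  change dY d.potential p = _ at h
  rw [inv_mul_DeltaY_mul_inv hd hp] at h
  rw [h]
  -- The terms with diag λ and its conjugate, from differentiating φ and φ*, cancel against those of
  -- RYR; only RTR survives.
  trans d.phi p ⬝ᵥ ((d.Delta p)⁻¹ * d.signMatrix * (d.Delta p)⁻¹) *ᵥ star (d.phi p)
  · congr 2
    abel
  · rw [phi_signMatrix_form]
    refine Finset.sum_congr rfl fun j _ => ?_
    rw [← star_q, mul_assoc, Complex.star_def, Complex.mul_conj, Complex.normSq_eq_norm_sq]

theorem S_eq_dY (i j : Fin m) {p : Pt} (hp : p ∈ d.regularSet) :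
    d.S i j p = 2 * dY (d.colForm i j) p := by
  rw [S_eq, invDeltaY_eq hp]
  congr 1
  have h := (HasMatDerivAt.vecMul_dotProduct (φ := fun _ => star (d.col i))
    (w := fun _ => d.col j) (a := 0) (b := 0)
    (fun k => by simpa using hasDerivAt_const _ (star (d.col i) k))
    (fun k => by simpa using hasDerivAt_const _ (d.col j k)) (hasMatDerivAt_inv_Delta_y hp)).deriv
  change dY (d.colForm i j) p = _ at h
  rw [h]
  simp

theorem dX_colForm (hd : d.Admissible) (i j : Fin m) {p : Pt} (hp : p ∈ d.regularSet) :
    dX (d.colForm i j) p = -(star (d.q i p) * d.q j p) := by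
  have h := (HasMatDerivAt.vecMul_dotProduct (φ := fun _ => star (d.col i))
    (w := fun _ => d.col j) (a := 0) (b := 0)
    (fun k => by simpa using hasDerivAt_const _ (star (d.col i) k))
    (fun k => by simpa using hasDerivAt_const _ (d.col j k))
    (hasMatDerivAt_inv_Delta_x hd hp)).deriv
  change dX (d.colForm i j) p = _ at h
  rw [h, star_q, q_eq]
  trans star (d.col i) ⬝ᵥ (-((d.Delta p)⁻¹ * d.rankOne p * (d.Delta p)⁻¹)) *ᵥ d.col j
  · simp
  · rw [Matrix.neg_mulVec, dotProduct_neg, rankOne, dotProduct_mul_vecMulVec_mul_mulVec]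

theorem contDiffOn_S (i j : Fin m) : ContDiffOn ℝ ∞ (d.S i j) d.regularSet :=
  (contDiffOn_const.mul (contDiffOn_dY d.isOpen_regularSet (d.contDiffOn_colForm i j))).congr
    fun _ hp => S_eq_dY i j hp

theorem q_equation (hd : d.Admissible) (i : Fin m) {p : Pt} (hp : p ∈ d.regularSet) :
    d.α * dT (d.q i) p = dX (dX (d.q i)) p + (d.c : ℂ) * dY (dY (d.q i)) p + d.v p * d.q i p
      - (d.c : ℂ) * ∑ j, (d.μ j : ℂ) * d.q j p * d.S j i p := by
  have hS : ∑ j, (d.μ j : ℂ) * d.q j p * d.S j i p =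
      d.phi p ⬝ᵥ (2 * ((d.Delta p)⁻¹ * d.signMatrix *
        -((d.Delta p)⁻¹ * d.DeltaY p * (d.Delta p)⁻¹))) *ᵥ d.col i := by
    rw [two_mul, Matrix.add_mulVec, dotProduct_add, phi_signMatrix_form, ← two_mul, Finset.mul_sum]
    refine Finset.sum_congr rfl fun j _ => ?_
    rw [S_eq, invDeltaY_eq hp]
    ring
  have hv : d.v p * d.q i p = d.phi p ⬝ᵥ (2 * ((Matrix.diagonal d.nu * (d.Delta p)⁻¹ +
      -((d.Delta p)⁻¹ * d.rankOne p * (d.Delta p)⁻¹) +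
      (d.Delta p)⁻¹ * Matrix.diagonal (star d.nu)) * d.rankOne p * (d.Delta p)⁻¹)) *ᵥ d.col i := by
    rw [two_mul, Matrix.add_mulVec, dotProduct_add, ← two_mul, v_eq, dX_potential hd hp, q_eq, mul_assoc]
    congr 1
    exact (dotProduct_mul_vecMulVec_mul_mulVec _ _ _ _ _ _).symm
  rw [alpha_mul_dT_q hd hp i rfl rfl rfl rfl rfl rfl rfl, hS, hv,
    dX_dX_q hd hp i rfl rfl rfl rfl, dY_dY_q hp i rfl rfl rfl rfl,
    x_part_identity, y_part_identity _ _ _ _ _ (inv_mul_DeltaY_mul_inv hd hp)]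
  rw [Matrix.add_mulVec _ (2 * _), dotProduct_add, Matrix.sub_mulVec _ (2 * _), dotProduct_sub]
  ring

theorem isDSSolutionOn (hd : d.Admissible) :
    IsDSSolutionOn d.α d.c d.μ d.regularSet d.q d.v d.S where
  isOpen := d.isOpen_regularSet
  smooth_q := d.contDiffOn_q
  smooth_v := d.contDiffOn_v
  smooth_S := contDiffOn_S
  eq_q i p hp := q_equation hd i hp
  eq_v p hp := by
    -- As v is twice the x-derivative of the potential, the equation is v_y = 2(u_y)_x by symmetry
    -- of mixed partials.
    rw [dY_congr d.isOpen_regularSet (fun r _ => d.v_eq r) hp, dY_const_mul,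
      ← dX_dY_comm d.isOpen_regularSet d.contDiffOn_potential hp,
      dX_congr d.isOpen_regularSet (fun r hr => dY_potential hd hr) hp]
  eq_S j i p hp := by
    rw [dX_congr d.isOpen_regularSet (fun r hr => S_eq_dY j i hr) hp, dX_const_mul,
      dX_dY_comm d.isOpen_regularSet (d.contDiffOn_colForm j i) hp,
      dY_congr d.isOpen_regularSet (fun r hr => dX_colForm hd j i hr) hp]
    simp only [neg_eq_neg_one_mul (star _ * _), dY_const_mul]
    ring

variable (d)

/-! ### Determinant formulas -/

/-- The Schur complement of Δ. At singular points both sides are 0 by the conventions for division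
and matrix inverse, so the formula can be rewritten under a derivative without a neighbourhood
argument. -/
theorem bordered_div_det (p : Pt) (u w : d.Idx → ℂ) :
    d.bordered p u w / (d.Delta p).det = -(w ⬝ᵥ (d.Delta p)⁻¹ *ᵥ u) := by
  by_cases h : (d.Delta p).det = 0
  · rw [h, div_zero, Matrix.nonsing_inv_apply_not_isUnit _ (by simp [h]), Matrix.zero_mulVec,
      dotProduct_zero, neg_zero]
  · let _ := Matrix.invertibleOfIsUnitDet (d.Delta p) (isUnit_iff_ne_zero.2 h)
    rw [bordered, Matrix.det_fromBlocks₁₁, mul_div_cancel_left₀ _ h, Matrix.det_unique,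
      Matrix.invOf_eq_nonsing_inv, Matrix.dotProduct_mulVec]
    simp [Matrix.mul_apply, dotProduct, Matrix.vecMul]

theorem q_eq_sum (j : Fin m) (p : Pt) : d.q j p = ∑ i : Fin (d.K j), d.Phi p ⟨j, i⟩ := by
  change ∑ a, d.Phi p a * d.P a j = _
  rw [Fintype.sum_sigma, Finset.sum_eq_single j]
  · simp [P]
  · intro b _ hb
    simp [P, hb]
  · simp

end Params

/-! ### Cauchy matrices with nodes in the right half-plane -/

section Cauchy

open scoped ComplexOrder

variable {ι : Type*}

/-- The Cauchy matrix `1 / (z_j + conj z_i)`. -/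
noncomputable def cauchyMatrix (z : ι → ℂ) : Matrix ι ι ℂ :=
  Matrix.of fun i j => 1 / (z j + star (z i))

theorem cauchyMatrix_neg (z : ι → ℂ) : cauchyMatrix (-z) = -cauchyMatrix z := by
  ext i j
  simp only [cauchyMatrix, Matrix.of_apply, Matrix.neg_apply, Pi.neg_apply, star_neg, ← neg_add,
    div_neg]

theorem cauchyMatrix_apply_eq_integral {z : ι → ℂ} (hz : ∀ j, 0 < (z j).re) (i j : ι) :
    cauchyMatrix z i j =
      ∫ s in Set.Ioi (0 : ℝ), Complex.exp (-(z j + star (z i)) * (s : ℂ)) := by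
  have h : (-(z j + star (z i))).re < 0 := by
    have := hz i; have := hz j
    simp; linarith
  rw [integral_exp_mul_complex_Ioi h 0]
  rw [Complex.ofReal_zero, mul_zero, Complex.exp_zero, neg_div_neg_eq]
  rfl

variable [Fintype ι]

theorem posSemidef_cauchyMatrix {z : ι → ℂ} (hz : ∀ j, 0 < (z j).re) :
    (cauchyMatrix z).PosSemidef := by
  refine .of_dotProduct_mulVec_nonneg ?_ fun x => ?_
  · ext i j
    simp [cauchyMatrix, Matrix.conjTranspose_apply, add_comm]
  · have hint : ∀ i j : ι, MeasureTheory.IntegrableOn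
        (fun s : ℝ => Complex.exp (-(z j + star (z i)) * (s : ℂ))) (Set.Ioi 0) := fun i j =>
      integrableOn_exp_mul_complex_Ioi (by
        have := hz i; have := hz j
        simp; linarith) 0
    -- The quadratic form is the squared L²(0,∞) norm of ∑ x_j e^{−z_j s}.
    have key : star x ⬝ᵥ cauchyMatrix z *ᵥ x = ((∫ s in Set.Ioi (0 : ℝ),
        Complex.normSq (∑ j, x j * Complex.exp (-z j * (s : ℂ))) : ℝ) : ℂ) := by
      rw [← integral_complex_ofReal]
      have e : ∀ s : ℝ, ((Complex.normSq (∑ j, x j * Complex.exp (-z j * (s : ℂ))) : ℝ) : ℂ) =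
          ∑ i, ∑ j, star (x i) * x j * Complex.exp (-(z j + star (z i)) * (s : ℂ)) := by
        intro s
        rw [Complex.normSq_eq_conj_mul_self, map_sum, Finset.sum_mul_sum]
        refine Finset.sum_congr rfl fun i _ => Finset.sum_congr rfl fun j _ => ?_
        rw [map_mul, ← Complex.exp_conj, map_mul, map_neg, Complex.conj_ofReal, neg_add, add_mul,
          Complex.exp_add, Complex.star_def]
        ring
      simp only [e]
      rw [MeasureTheory.integral_finsetSum _ fun i _ => MeasureTheory.integrable_finsetSum _
        fun j _ => (hint i j).const_mul _]
      simp only [dotProduct, Matrix.mulVec, Finset.mul_sum]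
      refine Finset.sum_congr rfl fun i _ => ?_
      rw [MeasureTheory.integral_finsetSum _ fun j _ => (hint i j).const_mul _]
      refine Finset.sum_congr rfl fun j _ => ?_
      rw [MeasureTheory.integral_const_mul, ← cauchyMatrix_apply_eq_integral hz, Pi.star_apply]
      ring
    rw [key, Complex.zero_le_real]
    exact MeasureTheory.integral_nonneg fun s => Complex.normSq_nonneg _

/-- On finitely many nodes every function agrees with a polynomial. Interpolating on the image of z
permits repeated nodes. -/
theorem sum_mul_eq_zero_of_moments {z x : ι → ℂ} (h : ∀ k : ℕ, ∑ j, z j ^ k * x j = 0)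
    (f : ℂ → ℂ) : ∑ j, f (z j) * x j = 0 := by
  classical
  have hp : ∀ p : Polynomial ℂ, ∑ j, p.eval (z j) * x j = 0 := by
    intro p
    simp only [Polynomial.eval_eq_sum_range, Finset.sum_mul]
    rw [Finset.sum_comm]
    refine Finset.sum_eq_zero fun k _ => ?_
    simp only [mul_assoc, ← Finset.mul_sum, h, mul_zero]
  rw [← hp (Lagrange.interpolate (Finset.univ.image z) id f)]
  refine Finset.sum_congr rfl fun j _ => ?_
  rw [← Lagrange.eval_interpolate_at_node (v := id) f Function.injective_id.injOn
    (Finset.mem_image_of_mem z (Finset.mem_univ j))]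
  rfl

/-- A null vector of the quadratic form of a Cauchy matrix sums to zero over the fibres of the
nodes. -/
theorem sum_mul_eq_zero_of_cauchyMatrix {z : ι → ℂ} (hz : ∀ j, 0 < (z j).re) {x : ι → ℂ}
    (h : star x ⬝ᵥ cauchyMatrix z *ᵥ x = 0) (f : ℂ → ℂ) : ∑ j, f (z j) * x j = 0 := by
  classical
  have lyap : Matrix.diagonal (star z) * cauchyMatrix z + cauchyMatrix z * Matrix.diagonal z =
      Matrix.vecMulVec 1 1 := by
    ext i j
    have : z j + star (z i) ≠ 0 := fun h0 => by
      have h1 := hz i; have h2 := hz j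
      have h3 := congrArg Complex.re h0
      simp at h3; linarith
    simp only [cauchyMatrix, Matrix.add_apply, Matrix.diagonal_mul, Matrix.mul_diagonal,
      Matrix.of_apply, Matrix.vecMulVec_apply, Pi.star_apply, Pi.one_apply]
    field_simp
    ring
  -- Applied to a kernel vector y, the Lyapunov identity says that the Cauchy matrix sends diag(z) y
  -- to the constant vector ∑ y_j. Pairing with y gives |∑ y_j|² = 0, so the kernel is stable under
  -- diag(z), and iteration yields all moments.
  have step : ∀ y : ι → ℂ, cauchyMatrix z *ᵥ y = 0 →
      ∑ j, y j = 0 ∧ cauchyMatrix z *ᵥ (Matrix.diagonal z *ᵥ y) = 0 := by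
    intro y hy
    have h1 : cauchyMatrix z *ᵥ (Matrix.diagonal z *ᵥ y) = fun _ => ∑ j, y j := by
      have h2 := congrArg (· *ᵥ y) lyap
      simp only [Matrix.add_mulVec, ← Matrix.mulVec_mulVec, hy, Matrix.mulVec_zero, zero_add] at h2
      rw [h2]
      funext i
      simp [Matrix.mulVec, dotProduct, Matrix.vecMulVec_apply]
    have h0 : ∑ j, y j = 0 := by
      have h3 : star y ⬝ᵥ cauchyMatrix z *ᵥ (Matrix.diagonal z *ᵥ y) = 0 := by
        rw [Matrix.dotProduct_mulVec, ← (posSemidef_cauchyMatrix hz).isHermitian.eq,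
          ← Matrix.star_mulVec, hy]
        simp
      rw [h1] at h3
      simp only [dotProduct, Pi.star_apply, ← Finset.sum_mul, ← star_sum] at h3
      exact (mul_eq_zero.1 h3).elim star_eq_zero.1 id
    refine ⟨h0, ?_⟩
    rw [h1, h0]
    rfl
  refine sum_mul_eq_zero_of_moments (fun k => ?_) f
  have hk : ∀ k : ℕ, cauchyMatrix z *ᵥ (fun j => z j ^ k * x j) = 0 := by
    intro k
    induction k with
    | zero => simpa using ((posSemidef_cauchyMatrix hz).dotProduct_mulVec_zero_iff x).1 h
    | succ k ih =>
      rw [← (step _ ih).2]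
      congr 1
      funext j
      rw [Matrix.mulVec_diagonal]
      ring
  exact (step _ (hk k)).1

/-- The quadratic form of the Cauchy matrix is nonnegative on vectors supported in the right
half-plane, and a null vector sums to zero over the fibres of the nodes. -/
theorem cauchyMatrix_form_of_support {z x : ι → ℂ} (hz : ∀ j, x j ≠ 0 → 0 < (z j).re) :
    0 ≤ (star x ⬝ᵥ cauchyMatrix z *ᵥ x).re ∧
      ((star x ⬝ᵥ cauchyMatrix z *ᵥ x).re = 0 → ∀ f : ℂ → ℂ, ∑ j, f (z j) * x j = 0) := by
  classical
  -- Nodes outside the support of x do not affect the form, so they may be moved into the right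
  -- half-plane; 1 is an arbitrary choice.
  set w : ι → ℂ := fun j => if 0 < (z j).re then z j else 1 with hw
  have hwpos : ∀ j, 0 < (w j).re := fun j => by
    simp only [hw]
    split_ifs with h
    · exact h
    · simp
  have hwz : ∀ j, x j ≠ 0 → w j = z j := fun j hj => if_pos (hz j hj)
  have hform : star x ⬝ᵥ cauchyMatrix z *ᵥ x = star x ⬝ᵥ cauchyMatrix w *ᵥ x := by
    simp only [dotProduct, Matrix.mulVec, cauchyMatrix, Matrix.of_apply, Finset.mul_sum]
    refine Finset.sum_congr rfl fun i _ => Finset.sum_congr rfl fun j _ => ?_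
    by_cases hi : x i = 0
    · simp [hi]
    · by_cases hj : x j = 0
      · simp [hj]
      · rw [hwz i hi, hwz j hj]
  have hnn := Complex.nonneg_iff.1 ((posSemidef_cauchyMatrix hwpos).dotProduct_mulVec_nonneg x)
  rw [hform]
  refine ⟨hnn.1, fun h0 f => ?_⟩
  rw [← sum_mul_eq_zero_of_cauchyMatrix hwpos (Complex.ext h0 hnn.2.symm) f]
  refine Finset.sum_congr rfl fun j _ => ?_
  by_cases hj : x j = 0
  · simp [hj]
  · rw [hwz j hj]

end Cauchy

namespace Params

/-! ### Regularity of the scalar multi-solitons -/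

section Regularity

variable {d : Params 1}

theorem C_eq_cauchyMatrix (hμ : d.μ 0 = 1) : d.C = cauchyMatrix d.lam := by
  ext ⟨s, i⟩ ⟨t, j⟩
  obtain rfl : s = t := Subsingleton.elim s t
  obtain rfl : s = 0 := Subsingleton.elim s 0
  simp [C, Matrix.blockDiagonal'_apply_eq, hμ, cauchyMatrix]

theorem Delta_mulVec_apply (hμ : d.μ 0 = 1) (p : Pt) (x : d.Idx → ℂ) (i : d.Idx) :
    (d.Delta p *ᵥ x) i = ∑ j, 1 / (d.lam j + star (d.lam i)) * x j +
      star (d.phi p i) * ∑ j, 1 / (d.nu j + star (d.nu i)) * (d.phi p j * x j) := by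
  rw [Delta, C_eq_cauchyMatrix hμ, Matrix.add_mulVec, Pi.add_apply, Finset.mul_sum]
  simp only [Matrix.mulVec, dotProduct]
  refine congrArg₂ _ rfl (Finset.sum_congr rfl fun j _ => ?_)
  simp only [gram, Matrix.of_apply]
  ring

theorem Delta_form (hμ : d.μ 0 = 1) (p : Pt) (x : d.Idx → ℂ) :
    star x ⬝ᵥ d.Delta p *ᵥ x = star x ⬝ᵥ cauchyMatrix d.lam *ᵥ x +
      star (d.phi p * x) ⬝ᵥ cauchyMatrix d.nu *ᵥ (d.phi p * x) := by
  simp only [dotProduct, ← Finset.sum_add_distrib]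
  refine Finset.sum_congr rfl fun i _ => ?_
  rw [Delta_mulVec_apply hμ, mul_add]
  refine congrArg₂ _ rfl ?_
  simp only [Matrix.mulVec, dotProduct, cauchyMatrix, Matrix.of_apply, Pi.star_apply, Pi.mul_apply,
    star_mul']
  ring

/-- The vector `x` sums to zero over the fibres of `λ`, and `φ x` over those of `ν`. -/
def FibreNull (d : Params 1) (p : Pt) (x : d.Idx → ℂ) : Prop :=
  (∀ f : ℂ → ℂ, ∑ j, f (d.lam j) * x j = 0) ∧
    ∀ f : ℂ → ℂ, ∑ j, f (d.nu j) * (d.phi p j * x j) = 0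

/-- For injective nodes, test against the indicator of one node. Otherwise use that φ_j factors as
F(ν_j) G(λ_j): fibre-nullity at p is carried to a point r with det Δ(r) ≠ 0 by rescaling x with
functions of λ alone. -/
theorem FibreNull.eq_zero (hμ : d.μ 0 = 1) {p : Pt} {x : d.Idx → ℂ} (hx : FibreNull d p x)
    (h : Function.Injective d.lam ∨ Function.Injective d.nu ∨ d.regularSet.Nonempty) : x = 0 := by
  rcases h with h | h | ⟨r, hr⟩
  · funext i
    have := hx.1 (fun z => if z = d.lam i then 1 else 0)
    simpa [h.eq_iff] using this
  · funext i
    have := hx.2 (fun z => if z = d.nu i then 1 else 0)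
    simpa [h.eq_iff, phi, Complex.exp_ne_zero] using this
  · set F : Pt → ℂ → ℂ := fun q z =>
      Complex.exp (z ^ 2 / d.α * (q.2.2 : ℂ) + z * (q.1 : ℂ)) with hF
    set G : Pt → ℂ → ℂ := fun q z =>
      Complex.exp ((d.c : ℂ) * z ^ 2 / d.α * (q.2.2 : ℂ) + z * (q.2.1 : ℂ)) with hG
    have hφ : ∀ q j, d.phi q j = F q (d.nu j) * G q (d.lam j) := fun q j => by
      simp only [phi, hF, hG, ← Complex.exp_add]
      congr 1
      ring
    have hF0 : ∀ q z, F q z ≠ 0 := fun q z => Complex.exp_ne_zero _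
    have hG0 : ∀ q z, G q z ≠ 0 := fun q z => Complex.exp_ne_zero _
    -- The λ-sum is a function of λ_j against x. In the ν-sum, φ_r G_p/G_r = (F_r/F_p) φ_p, a
    -- function of ν_j against φ_p x. Both vanish, so Δ(r) kills the rescaled vector.
    have hw : (fun j => G p (d.lam j) / G r (d.lam j) * x j) = 0 := by
      refine Matrix.eq_zero_of_mulVec_eq_zero (M := d.Delta r) hr ?_
      funext i
      rw [Delta_mulVec_apply hμ]
      have h1 := hx.1 fun z => 1 / (z + star (d.lam i)) * (G p z / G r z)
      have h2 := hx.2 fun z => 1 / (z + star (d.nu i)) * (F r z / F p z)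
      have h3 : ∀ j, 1 / (d.nu j + star (d.nu i)) *
          (d.phi r j * (G p (d.lam j) / G r (d.lam j) * x j)) =
          1 / (d.nu j + star (d.nu i)) * (F r (d.nu j) / F p (d.nu j)) * (d.phi p j * x j) := by
        intro j
        rw [hφ, hφ]
        generalize 1 / (d.nu j + star (d.nu i)) = k
        have := hF0 p (d.nu j)
        have := hG0 r (d.lam j)
        field_simp
      rw [Finset.sum_congr rfl fun j _ => h3 j, h2, mul_zero, add_zero]
      exact (Finset.sum_congr rfl fun j _ => (mul_assoc _ _ _).symm).trans h1
    funext j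
    have := congrFun hw j
    simpa [hG0] using this

theorem fibreNull_of_support_pos (hμ : d.μ 0 = 1) (p : Pt) {x : d.Idx → ℂ}
    (hl : ∀ j, x j ≠ 0 → 0 < (d.lam j).re) (hn : ∀ j, x j ≠ 0 → 0 < (d.nu j).re) :
    0 ≤ (star x ⬝ᵥ d.Delta p *ᵥ x).re ∧
      ((star x ⬝ᵥ d.Delta p *ᵥ x).re = 0 → FibreNull d p x) := by
  have h1 := cauchyMatrix_form_of_support hl
  have h2 := cauchyMatrix_form_of_support (x := d.phi p * x) (z := d.nu)
    fun j hj => hn j (right_ne_zero_of_mul hj)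
  rw [Delta_form hμ, Complex.add_re]
  exact ⟨add_nonneg h1.1 h2.1, fun h => ⟨h1.2 (by linarith [h1.1, h2.1]),
    h2.2 (by linarith [h1.1, h2.1])⟩⟩

theorem fibreNull_of_support_neg (hμ : d.μ 0 = 1) (p : Pt) {x : d.Idx → ℂ}
    (hl : ∀ j, x j ≠ 0 → (d.lam j).re < 0) (hn : ∀ j, x j ≠ 0 → (d.nu j).re < 0) :
    (star x ⬝ᵥ d.Delta p *ᵥ x).re ≤ 0 ∧
      ((star x ⬝ᵥ d.Delta p *ᵥ x).re = 0 → FibreNull d p x) := by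
  have h1 := cauchyMatrix_form_of_support (z := -d.lam) (x := x)
    fun j hj => by simpa using hl j hj
  have h2 := cauchyMatrix_form_of_support (x := d.phi p * x) (z := -d.nu)
    fun j hj => by simpa using hn j (right_ne_zero_of_mul hj)
  rw [cauchyMatrix_neg, Matrix.neg_mulVec, dotProduct_neg, Complex.neg_re] at h1 h2
  rw [Delta_form hμ, Complex.add_re]
  refine ⟨by linarith [h1.1, h2.1], fun h => ⟨fun f => ?_, fun f => ?_⟩⟩
  -- The nodes were negated, so the test function is reflected.
  · simpa using h1.2 (by linarith [h1.1, h2.1]) fun z => f (-z)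
  · simpa using h2.2 (by linarith [h1.1, h2.1]) fun z => f (-z)

/-- A kernel vector is split as a + b by the sign of Re λ, which is also the sign of Re ν. Pairing
the kernel equation with a and with b, and using Re⟨b, Δa⟩ = Re⟨a, Δb⟩, gives Re⟨a, Δa⟩ = Re⟨b, Δb⟩;
the first is ≥ 0 and the second ≤ 0, so both vanish. -/
theorem det_Delta_ne_zero (hμ : d.μ 0 = 1) (hre : ∀ a, 0 < (d.lam a).re * (d.nu a).re)
    (h : Function.Injective d.lam ∨ Function.Injective d.nu ∨ d.regularSet.Nonempty) (p : Pt) :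
    (d.Delta p).det ≠ 0 := by
  intro hdet
  obtain ⟨z, hz0, hz⟩ := Matrix.exists_mulVec_eq_zero_iff.2 hdet
  set a : d.Idx → ℂ := fun j => if 0 < (d.lam j).re then z j else 0 with ha
  set b : d.Idx → ℂ := fun j => if 0 < (d.lam j).re then 0 else z j with hb
  have hab : a + b = z := by
    funext j
    simp only [ha, hb, Pi.add_apply]
    split_ifs <;> simp
  have hla : ∀ j, a j ≠ 0 → 0 < (d.lam j).re := fun j hj => by
    by_contra hlt
    exact hj (if_neg hlt)
  have hlb : ∀ j, b j ≠ 0 → (d.lam j).re < 0 := fun j hj => by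
    have hle : ¬ 0 < (d.lam j).re := fun hlt => hj (if_pos hlt)
    exact lt_of_le_of_ne (not_lt.1 hle) (left_ne_zero_of_mul (hre j).ne')
  obtain ⟨hpa, hna⟩ := fibreNull_of_support_pos hμ p hla
    fun j hj => (pos_iff_pos_of_mul_pos (hre j)).1 (hla j hj)
  obtain ⟨hpb, hnb⟩ := fibreNull_of_support_neg hμ p hlb
    fun j hj => (neg_iff_neg_of_mul_pos (hre j)).1 (hlb j hj)
  rw [← hab, Matrix.mulVec_add] at hz
  have e1 : star a ⬝ᵥ d.Delta p *ᵥ a + star a ⬝ᵥ d.Delta p *ᵥ b = 0 := by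
    rw [← dotProduct_add, hz, dotProduct_zero]
  have e2 : star b ⬝ᵥ d.Delta p *ᵥ a + star b ⬝ᵥ d.Delta p *ᵥ b = 0 := by
    rw [← dotProduct_add, hz, dotProduct_zero]
  have e3 : star b ⬝ᵥ d.Delta p *ᵥ a = star (star a ⬝ᵥ d.Delta p *ᵥ b) := by
    rw [← Matrix.star_dotProduct_star, star_star, Matrix.star_mulVec, Delta_conjTranspose,
      Matrix.dotProduct_mulVec]
  have r1 := congrArg Complex.re e1
  have r2 := congrArg Complex.re e2
  rw [e3] at r2
  simp only [Complex.add_re, Complex.zero_re, Complex.star_def, Complex.conj_re] at r1 r2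
  have ha0 : a = 0 := (hna (by linarith)).eq_zero hμ h
  have hb0 : b = 0 := (hnb (by linarith)).eq_zero hμ h
  exact hz0 (by rw [← hab, ha0, hb0, add_zero])

end Regularity

end Params

theorem IsDSSolutionOn.congr {m : ℕ} {α : ℂ} {c : ℝ} {μ : Fin m → ℝ} {U : Set Pt}
    {q q' : Fin m → Pt → ℂ} {v v' : Pt → ℂ} {S S' : Fin m → Fin m → Pt → ℂ}
    (h : IsDSSolutionOn α c μ U q v S) (hq : ∀ i, Set.EqOn (q' i) (q i) U) (hv : Set.EqOn v' v U)
    (hS : ∀ j i, Set.EqOn (S' j i) (S j i) U) : IsDSSolutionOn α c μ U q' v' S' where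
  isOpen := h.isOpen
  smooth_q i := (h.smooth_q i).congr (hq i)
  smooth_v := h.smooth_v.congr hv
  smooth_S j i := (h.smooth_S j i).congr (hS j i)
  eq_q i p hp := by
    rw [dT_congr h.isOpen (hq i) hp,
      dX_congr h.isOpen (fun r hr => dX_congr h.isOpen (hq i) hr) hp,
      dY_congr h.isOpen (fun r hr => dY_congr h.isOpen (hq i) hr) hp, hv hp, hq i hp, h.eq_q i p hp]
    simp only [hq _ hp, hS _ _ hp]
  eq_v p hp := by
    rw [dY_congr h.isOpen hv hp, h.eq_v p hp]
    congr 1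
    exact dX_congr h.isOpen (fun r hr => by simp only [hq _ hr]) hp
  eq_S j i p hp := by
    rw [dX_congr h.isOpen (hS j i) hp, h.eq_S j i p hp]
    congr 1
    exact dY_congr h.isOpen (fun r hr => by simp only [hq _ hr]) hp

/-! ### The one-soliton -/

section OneSoliton

variable {α : ℂ} {c μ₁ : ℝ} {lam₁ nu₁ : ℂ}

theorem add_star_eq (z : ℂ) : z + star z = ((2 * z.re : ℝ) : ℂ) := Complex.add_conj z

theorem add_star_ne_zero {z : ℂ} (hz : z.re ≠ 0) : z + star z ≠ 0 := by
  rw [add_star_eq]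
  exact_mod_cast mul_ne_zero two_ne_zero hz

theorem oneParams_admissible (hα : α.re = 0) (hα0 : α ≠ 0) (hμ : μ₁ = 1 ∨ μ₁ = -1)
    (hl : lam₁.re ≠ 0) (hn : nu₁.re ≠ 0) : (oneParams α c μ₁ lam₁ nu₁).Admissible where
  α_re := hα
  α_ne := hα0
  μ_sign _ := hμ
  lam_ne _ _ _ := add_star_ne_zero hl
  nu_ne _ _ := add_star_ne_zero hn

/-- The only index of the one-soliton. -/
def oneIdx (α : ℂ) (c μ₁ : ℝ) (lam₁ nu₁ : ℂ) : (oneParams α c μ₁ lam₁ nu₁).Idx :=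
  ⟨0, (0 : Fin 1)⟩

theorem eq_oneIdx (a : (oneParams α c μ₁ lam₁ nu₁).Idx) : a = oneIdx α c μ₁ lam₁ nu₁ := by
  obtain ⟨s, i⟩ := a
  obtain rfl : s = 0 := Subsingleton.elim s 0
  have h : i = (0 : Fin 1) := Subsingleton.elim (α := Fin 1) i 0
  subst h
  rfl

instance : Unique (oneParams α c μ₁ lam₁ nu₁).Idx where
  default := oneIdx α c μ₁ lam₁ nu₁
  uniq := eq_oneIdx

theorem oneParams_phi (p : Pt) (a : (oneParams α c μ₁ lam₁ nu₁).Idx) :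
    (oneParams α c μ₁ lam₁ nu₁).phi p a = Complex.exp (theta α c lam₁ nu₁ p) := rfl

theorem star_exp_mul_exp (z : ℂ) :
    star (Complex.exp z) * Complex.exp z = ((Real.exp (2 * z.re) : ℝ) : ℂ) := by
  rw [Complex.star_def, ← Complex.exp_conj, ← Complex.exp_add, add_comm, Complex.add_conj,
    Complex.ofReal_exp]

theorem oneParams_Delta_apply (p : Pt) (a b : (oneParams α c μ₁ lam₁ nu₁).Idx) :
    (oneParams α c μ₁ lam₁ nu₁).Delta p a b = (oneDelta α c μ₁ lam₁ nu₁ p : ℂ) := by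
  rw [eq_oneIdx a, eq_oneIdx b]
  refine (congrArg₂ (fun z w : ℂ => z + w) (Matrix.blockDiagonal'_apply_eq _ _ _ _) rfl).trans ?_
  change (μ₁ : ℂ) * (1 / (lam₁ + star lam₁)) + star (Complex.exp (theta α c lam₁ nu₁ p)) *
    Complex.exp (theta α c lam₁ nu₁ p) / (nu₁ + star nu₁) = _
  rw [star_exp_mul_exp, add_star_eq, add_star_eq, oneDelta]
  push_cast
  ring

theorem oneParams_det_Delta (p : Pt) :
    ((oneParams α c μ₁ lam₁ nu₁).Delta p).det = (oneDelta α c μ₁ lam₁ nu₁ p : ℂ) := by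
  rw [Matrix.det_unique, oneParams_Delta_apply]

theorem oneParams_regularSet : (oneParams α c μ₁ lam₁ nu₁).regularSet =
    {p | oneDelta α c μ₁ lam₁ nu₁ p ≠ 0} := by
  ext p
  change ((oneParams α c μ₁ lam₁ nu₁).Delta p).det ≠ 0 ↔ _
  rw [oneParams_det_Delta]
  exact Complex.ofReal_ne_zero

theorem oneParams_inv_Delta_apply (p : Pt) (a b : (oneParams α c μ₁ lam₁ nu₁).Idx) :
    ((oneParams α c μ₁ lam₁ nu₁).Delta p)⁻¹ a b = ((oneDelta α c μ₁ lam₁ nu₁ p)⁻¹ : ℝ) := by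
  rw [Matrix.inv_subsingleton, Matrix.diagonal_apply, if_pos (Subsingleton.elim a b),
    oneParams_Delta_apply, Ring.inverse_eq_inv', Complex.ofReal_inv]

theorem oneParams_col (a : (oneParams α c μ₁ lam₁ nu₁).Idx) :
    (oneParams α c μ₁ lam₁ nu₁).col 0 a = 1 := by
  rw [eq_oneIdx a]
  rfl

theorem oneParams_q (p : Pt) :
    (oneParams α c μ₁ lam₁ nu₁).q 0 p = oneQ α c μ₁ lam₁ nu₁ p := by
  rw [Params.q_eq]
  simp only [dotProduct, Matrix.mulVec, Fintype.sum_unique, oneParams_phi,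
    oneParams_inv_Delta_apply, oneParams_col, oneQ, mul_one, Complex.ofReal_inv, div_eq_mul_inv]

theorem oneParams_potential (p : Pt) :
    (oneParams α c μ₁ lam₁ nu₁).potential p =
      ((Real.exp (2 * (theta α c lam₁ nu₁ p).re) / oneDelta α c μ₁ lam₁ nu₁ p : ℝ) : ℂ) := by
  simp only [Params.potential, dotProduct, Matrix.mulVec, Fintype.sum_unique, oneParams_phi,
    oneParams_inv_Delta_apply, Pi.star_apply]
  rw [mul_left_comm, mul_comm (Complex.exp _), star_exp_mul_exp, ← Complex.ofReal_mul,
    div_eq_mul_inv, mul_comm]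

theorem oneParams_colForm (p : Pt) :
    (oneParams α c μ₁ lam₁ nu₁).colForm 0 0 p = ((oneDelta α c μ₁ lam₁ nu₁ p)⁻¹ : ℝ) := by
  simp only [Params.colForm, dotProduct, Matrix.mulVec, Fintype.sum_unique,
    oneParams_inv_Delta_apply, Pi.star_apply, oneParams_col, star_one, one_mul, mul_one]

theorem hasDerivAt_exp_theta_x (p : Pt) :
    HasDerivAt (fun s : ℝ => Real.exp (2 * (theta α c lam₁ nu₁ (s, p.2.1, p.2.2)).re))
      (2 * nu₁.re * Real.exp (2 * (theta α c lam₁ nu₁ p).re)) p.1 := by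
  have h : HasDerivAt (fun s : ℝ => 2 * (theta α c lam₁ nu₁ (s, p.2.1, p.2.2)).re)
      (2 * nu₁.re) p.1 := by
    simp only [theta, Complex.add_re, Complex.re_mul_ofReal]
    simpa using ((((hasDerivAt_id p.1).const_mul nu₁.re).const_add _).add_const _).const_mul 2
  exact h.exp.congr_deriv (mul_comm _ _)

theorem hasDerivAt_exp_theta_y (p : Pt) :
    HasDerivAt (fun s : ℝ => Real.exp (2 * (theta α c lam₁ nu₁ (p.1, s, p.2.2)).re))
      (2 * lam₁.re * Real.exp (2 * (theta α c lam₁ nu₁ p).re)) p.2.1 := by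
  have h : HasDerivAt (fun s : ℝ => 2 * (theta α c lam₁ nu₁ (p.1, s, p.2.2)).re)
      (2 * lam₁.re) p.2.1 := by
    simp only [theta, Complex.add_re, Complex.re_mul_ofReal]
    simpa using (((hasDerivAt_id p.2.1).const_mul lam₁.re).const_add _).const_mul 2
  exact h.exp.congr_deriv (mul_comm _ _)

theorem oneParams_v (hl : lam₁.re ≠ 0) (hn : nu₁.re ≠ 0) {p : Pt}
    (hp : oneDelta α c μ₁ lam₁ nu₁ p ≠ 0) :
    (oneParams α c μ₁ lam₁ nu₁).v p = oneV α c μ₁ lam₁ nu₁ p := by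
  have hE := hasDerivAt_exp_theta_x (α := α) (c := c) (lam₁ := lam₁) (nu₁ := nu₁) p
  have hD : HasDerivAt (fun s : ℝ => oneDelta α c μ₁ lam₁ nu₁ (s, p.2.1, p.2.2)) _ p.1 :=
    (hE.const_mul (1 / (2 * nu₁.re))).const_add (μ₁ / (2 * lam₁.re))
  have h := (hE.div hD hp).ofReal_comp.deriv
  change dX (fun r => ((Real.exp (2 * (theta α c lam₁ nu₁ r).re) /
    oneDelta α c μ₁ lam₁ nu₁ r : ℝ) : ℂ)) p = _ at h
  rw [← funext oneParams_potential] at h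
  rw [Params.v_eq, h, oneV]
  rw [show (2 : ℂ) = ((2 : ℝ) : ℂ) by norm_num, ← Complex.ofReal_mul, Complex.ofReal_inj]
  have hp' : oneDelta α c μ₁ lam₁ nu₁ (p.1, p.2.1, p.2.2) = oneDelta α c μ₁ lam₁ nu₁ p := rfl
  have hp'' : theta α c lam₁ nu₁ (p.1, p.2.1, p.2.2) = theta α c lam₁ nu₁ p := rfl
  rw [hp', hp'']
  -- With E = e^{2 Re θ}, the quotient rule leaves E(2 Re ν · Δ − E)/Δ², and the bracket equals μ₁
  -- Re ν / Re λ by the definition of Δ.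
  have hdef : oneDelta α c μ₁ lam₁ nu₁ p = μ₁ / (2 * lam₁.re) +
    1 / (2 * nu₁.re) * Real.exp (2 * (theta α c lam₁ nu₁ p).re) := rfl
  field_simp at hdef ⊢
  linear_combination hdef

theorem oneParams_S (hl : lam₁.re ≠ 0) (hn : nu₁.re ≠ 0) {p : Pt}
    (hp : oneDelta α c μ₁ lam₁ nu₁ p ≠ 0) :
    (oneParams α c μ₁ lam₁ nu₁).S 0 0 p = oneS α c μ₁ lam₁ nu₁ p := by
  have hE := hasDerivAt_exp_theta_y (α := α) (c := c) (lam₁ := lam₁) (nu₁ := nu₁) p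
  have hD : HasDerivAt (fun s : ℝ => oneDelta α c μ₁ lam₁ nu₁ (p.1, s, p.2.2)) _ p.2.1 :=
    (hE.const_mul (1 / (2 * nu₁.re))).const_add (μ₁ / (2 * lam₁.re))
  have h := (hD.inv hp).ofReal_comp.deriv
  change dY (fun r => ((oneDelta α c μ₁ lam₁ nu₁ r)⁻¹ : ℝ)) p = _ at h
  rw [← funext oneParams_colForm] at h
  rw [Params.S_eq_dY 0 0 (by rwa [oneParams_regularSet]), h, oneS]
  rw [show (2 : ℂ) = ((2 : ℝ) : ℂ) by norm_num, ← Complex.ofReal_mul, Complex.ofReal_inj]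
  have hp' : oneDelta α c μ₁ lam₁ nu₁ (p.1, p.2.1, p.2.2) = oneDelta α c μ₁ lam₁ nu₁ p := rfl
  rw [hp']
  field_simp

theorem oneSoliton_isDSSolutionOn (hα : α.re = 0) (hα0 : α ≠ 0) (hμ : μ₁ = 1 ∨ μ₁ = -1)
    (hl : lam₁.re ≠ 0) (hn : nu₁.re ≠ 0) :
    IsDSSolutionOn α c (fun _ : Fin 1 => μ₁) {p | oneDelta α c μ₁ lam₁ nu₁ p ≠ 0}
      (fun _ => oneQ α c μ₁ lam₁ nu₁) (oneV α c μ₁ lam₁ nu₁) (fun _ _ => oneS α c μ₁ lam₁ nu₁) := by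
  have h := Params.isDSSolutionOn (oneParams_admissible (c := c) hα hα0 hμ hl hn)
  rw [oneParams_regularSet] at h
  refine IsDSSolutionOn.congr h (fun i p _ => ?_) (fun p hp => (oneParams_v hl hn hp).symm)
    fun j i p hp => ?_
  · rw [Subsingleton.elim i 0, oneParams_q]
  · rw [Subsingleton.elim i 0, Subsingleton.elim j 0, oneParams_S hl hn hp]

theorem oneDelta_ne_zero (h : 0 < lam₁.re * nu₁.re) (p : Pt) : oneDelta α c 1 lam₁ nu₁ p ≠ 0 := by
  have hl : lam₁.re ≠ 0 := left_ne_zero_of_mul h.ne'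
  have hn : nu₁.re ≠ 0 := right_ne_zero_of_mul h.ne'
  intro h0
  have hE := Real.exp_pos (2 * (theta α c lam₁ nu₁ p).re)
  simp only [oneDelta] at h0
  field_simp at h0
  -- Multiplying by Re λ avoids splitting on signs: the first summand is positive, the second
  -- nonnegative.
  have : lam₁.re * nu₁.re + lam₁.re ^ 2 * Real.exp (2 * (theta α c lam₁ nu₁ p).re) = 0 := by
    linear_combination lam₁.re * h0
  nlinarith [mul_nonneg (sq_nonneg lam₁.re) hE.le]

theorem exists_oneDelta_eq_zero (h : 0 < lam₁.re * nu₁.re) :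
    ∃ p, oneDelta α c (-1) lam₁ nu₁ p = 0 := by
  have hl : lam₁.re ≠ 0 := left_ne_zero_of_mul h.ne'
  have hn : nu₁.re ≠ 0 := right_ne_zero_of_mul h.ne'
  have hpos : 0 < nu₁.re / lam₁.re := by
    have : nu₁.re / lam₁.re = lam₁.re * nu₁.re / lam₁.re ^ 2 := by field_simp
    rw [this]
    positivity
  -- On the line y = t = 0, x is chosen so that e^{2 Re θ} = Re ν / Re λ, which balances the two
  -- terms of Δ.
  refine ⟨(Real.log (nu₁.re / lam₁.re) / (2 * nu₁.re), 0, 0), ?_⟩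
  have e : 2 * (theta α c lam₁ nu₁ (Real.log (nu₁.re / lam₁.re) / (2 * nu₁.re), 0, 0)).re =
      Real.log (nu₁.re / lam₁.re) := by
    simp only [theta, Complex.add_re, Complex.re_mul_ofReal, mul_zero, zero_add, add_zero]
    field_simp
  rw [oneDelta, e, Real.exp_log hpos]
  field_simp
  ring

theorem continuous_theta : Continuous (theta α c lam₁ nu₁) := by
  unfold theta
  fun_prop

theorem continuous_oneDelta : Continuous (oneDelta α c μ₁ lam₁ nu₁) := by
  have := (continuous_theta (α := α) (c := c) (lam₁ := lam₁) (nu₁ := nu₁))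
  unfold oneDelta
  fun_prop

theorem tendsto_norm_oneQ {p₀ : Pt} (h0 : oneDelta α c μ₁ lam₁ nu₁ p₀ = 0) :
    Filter.Tendsto (fun p => ‖oneQ α c μ₁ lam₁ nu₁ p‖)
      (nhdsWithin p₀ {p | oneDelta α c μ₁ lam₁ nu₁ p ≠ 0}) Filter.atTop := by
  have hnum : Filter.Tendsto (fun p => ‖Complex.exp (theta α c lam₁ nu₁ p)‖)
      (nhdsWithin p₀ {p | oneDelta α c μ₁ lam₁ nu₁ p ≠ 0})
      (nhds ‖Complex.exp (theta α c lam₁ nu₁ p₀)‖) :=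
    (continuous_theta.cexp.norm.tendsto p₀).mono_left nhdsWithin_le_nhds
  have hden : Filter.Tendsto (fun p => |oneDelta α c μ₁ lam₁ nu₁ p|)
      (nhdsWithin p₀ {p | oneDelta α c μ₁ lam₁ nu₁ p ≠ 0}) (nhdsWithin 0 (Set.Ioi 0)) := by
    refine tendsto_nhdsWithin_iff.2 ⟨?_, eventually_mem_nhdsWithin.mono fun p hp => abs_pos.2 hp⟩
    have := (continuous_oneDelta (α := α) (c := c) (μ₁ := μ₁) (lam₁ := lam₁)
      (nu₁ := nu₁)).abs.tendsto p₀
    rw [h0, abs_zero] at this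
    exact this.mono_left nhdsWithin_le_nhds
  refine (hnum.pos_mul_atTop (norm_pos_iff.2 (Complex.exp_ne_zero _))
    hden.inv_tendsto_nhdsGT_zero).congr fun p => ?_
  rw [oneQ, norm_div, Complex.norm_real, Real.norm_eq_abs, div_eq_mul_inv]
  rfl

end OneSoliton

end VectorDS

theorem mainTheorem8 :
    -- `q`, `v_0`, `S` solve the `m`-component system and are given by determinants
    (∀ (m : ℕ) (d : VectorDS.Params m), d.Admissible →
      VectorDS.IsDSSolutionOn d.α d.c d.μ d.regularSet d.q d.v d.S ∧
      ∀ p ∈ d.regularSet,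
        (∀ j : Fin m,
          d.q j p = ∑ i : Fin (d.K j), d.Phi p ⟨j, i⟩ ∧
          d.q j p = -(d.bordered p (fun a => d.P a j) (d.phi p) / (d.Delta p).det)) ∧
        d.v p = -2 * VectorDS.dX
          (fun r => d.bordered r (star (d.phi r)) (d.phi r) / (d.Delta r).det) p ∧
        (∀ i j : Fin m,
          d.S i j p = -2 * VectorDS.dY
            (fun r => d.bordered r (fun a => d.P a j) (star fun a => d.P a i)
              / (d.Delta r).det) p)) ∧
    -- regularity of the scalar multi-soliton for `μ_1 = 1`
    (∀ d : VectorDS.Params 1, d.Admissible → d.μ 0 = 1 →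
      (∀ a, 0 < (d.lam a).re * (d.nu a).re) →
      (Function.Injective d.lam ∨ Function.Injective d.nu ∨ d.regularSet.Nonempty) →
      (∀ p, (d.Delta p).det ≠ 0) ∧
      VectorDS.IsDSSolutionOn d.α d.c d.μ Set.univ d.q d.v d.S) ∧
    -- the explicit one-soliton
    (∀ (α : ℂ) (c μ₁ : ℝ) (lam₁ nu₁ : ℂ), α.re = 0 → α ≠ 0 → (μ₁ = 1 ∨ μ₁ = -1) →
      lam₁.re ≠ 0 → nu₁.re ≠ 0 →
      (∀ p, ((VectorDS.oneParams α c μ₁ lam₁ nu₁).Delta p).det =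
        (VectorDS.oneDelta α c μ₁ lam₁ nu₁ p : ℂ)) ∧
      (∀ p, VectorDS.oneDelta α c μ₁ lam₁ nu₁ p ≠ 0 →
        (VectorDS.oneParams α c μ₁ lam₁ nu₁).q 0 p = VectorDS.oneQ α c μ₁ lam₁ nu₁ p ∧
        (VectorDS.oneParams α c μ₁ lam₁ nu₁).v p = VectorDS.oneV α c μ₁ lam₁ nu₁ p ∧
        (VectorDS.oneParams α c μ₁ lam₁ nu₁).S 0 0 p = VectorDS.oneS α c μ₁ lam₁ nu₁ p) ∧
      VectorDS.IsDSSolutionOn α c (fun _ : Fin 1 => μ₁)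
        {p | VectorDS.oneDelta α c μ₁ lam₁ nu₁ p ≠ 0}
        (fun _ => VectorDS.oneQ α c μ₁ lam₁ nu₁) (VectorDS.oneV α c μ₁ lam₁ nu₁)
        (fun _ _ => VectorDS.oneS α c μ₁ lam₁ nu₁) ∧
      (0 < lam₁.re * nu₁.re →
        (μ₁ = 1 → (∀ p, VectorDS.oneDelta α c μ₁ lam₁ nu₁ p ≠ 0) ∧
          VectorDS.IsDSSolutionOn α c (fun _ : Fin 1 => μ₁) Set.univ
            (fun _ => VectorDS.oneQ α c μ₁ lam₁ nu₁) (VectorDS.oneV α c μ₁ lam₁ nu₁)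
            (fun _ _ => VectorDS.oneS α c μ₁ lam₁ nu₁)) ∧
        (μ₁ = -1 → ∃ p₀, VectorDS.oneDelta α c μ₁ lam₁ nu₁ p₀ = 0 ∧
          Filter.Tendsto (fun p => ‖VectorDS.oneQ α c μ₁ lam₁ nu₁ p‖)
            (nhdsWithin p₀ {p | VectorDS.oneDelta α c μ₁ lam₁ nu₁ p ≠ 0}) Filter.atTop))) := by
  refine ⟨fun m d hd => ⟨VectorDS.Params.isDSSolutionOn hd,
    fun p hp => ⟨fun j => ⟨d.q_eq_sum j p, ?_⟩, ?_, fun i j => ?_⟩⟩, fun d hd hμ hre h => ?_, fun α c μ₁ lam₁ nu₁ hα hα0 hμ hl hn => ?_⟩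
  · rw [VectorDS.Params.bordered_div_det, neg_neg, VectorDS.Params.q_eq]
    rfl
  · simp only [VectorDS.Params.bordered_div_det, neg_eq_neg_one_mul (_ ⬝ᵥ _)]
    rw [VectorDS.dX_const_mul, VectorDS.Params.v_eq]
    change _ = -2 * (-1 * VectorDS.dX d.potential p)
    ring
  · simp only [VectorDS.Params.bordered_div_det, neg_eq_neg_one_mul (_ ⬝ᵥ _)]
    rw [VectorDS.dY_const_mul, VectorDS.Params.S_eq_dY i j hp]
    change _ = -2 * (-1 * VectorDS.dY (d.colForm i j) p)
    ring
  · have hdet := VectorDS.Params.det_Delta_ne_zero hμ hre h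
    have hU : d.regularSet = Set.univ := Set.eq_univ_of_forall hdet
    exact ⟨hdet, hU ▸ VectorDS.Params.isDSSolutionOn hd⟩
  · have hsol := VectorDS.oneSoliton_isDSSolutionOn (c := c) hα hα0 hμ hl hn
    refine ⟨VectorDS.oneParams_det_Delta, fun p hp => ⟨VectorDS.oneParams_q p,
      VectorDS.oneParams_v hl hn hp, VectorDS.oneParams_S hl hn hp⟩, hsol,
      fun hpos => ⟨?_, ?_⟩⟩
    · rintro rfl
      have hne := VectorDS.oneDelta_ne_zero (α := α) (c := c) hpos
      have hU : {p | VectorDS.oneDelta α c 1 lam₁ nu₁ p ≠ 0} = Set.univ :=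
        Set.eq_univ_of_forall hne
      exact ⟨hne, hU ▸ hsol⟩
    · rintro rfl
      obtain ⟨p₀, hp₀⟩ := VectorDS.exists_oneDelta_eq_zero (α := α) (c := c) hpos
      exact ⟨p₀, hp₀, VectorDS.tendsto_norm_oneQ hp₀⟩
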